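/- Let $N\ge 2$ and $0\le k\le N$ be integers, let $\Omega=\mathbb{R}^{N,k}_+:=\mathbb{R}^{N-k}\times(0,\infty)^k\subset\mathbb{R}^N$, and let $\lambda$ be a real number with $\lambda\le\lambda_{N,k}:=\left(\frac{N-2}{2}+k\right)^2$ (the critical value $\lambda=\lambda_{N,k}$ is allowed). For real-valued $v\in C_c^\infty(\Omega)$ put $$l_\lambda[v]:=\int_{\Omega}\left(|\nabla v|^2-\frac{\lambda}{|x|^2}|v|^2+\frac{|x|^2}{16}|v|^2\right)dx ,$$ and let $\mathcal C_\lambda$ be the space of all $v\in C_c^\infty(\Omega)$ with $\int_\Omega \frac{|\lambda|}{|x|^2}|v|^2\,dx<\infty$; thus $\mathcal C_\lambda=C_c^\infty(\Omega)$, unless $N=2$, $k=0$ and $\lambda<0$. Then $l_\lambda\ge 0$ on $\mathcal C_\lambda$. Let $H_\lambda$ be the Hilbert space completion of $\mathcal C_\lambda$ with respect to $\|v\|_{l_\lambda}:=\sqrt{l_\lambda[v]}$. The inclusion $\mathcal C_\lambda\subset L^2(\Omega)$ extends to a continuous linear map $H_\lambda\to L^2(\Omega)$, and this map is injective and compact.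 In other words, $H_\lambda$ embeds compactly into $L^2(\Omega)$. -/

import Mathlib

open MeasureTheory Set TopologicalSpace
open scoped Distributions Gradient

noncomputable section

namespace HardyForm

/-- The set `ℝ^{N-k} × (0,∞)^k` in `ℝ^N` (coordinates indexed from `0`): the last `k` coordinates
are positive. It is meant for `k ≤ N`. -/
def orthant (N k : ℕ) : Opens (EuclideanSpace ℝ (Fin N)) where
  carrier := {x | ∀ i : Fin N, N - k ≤ (i : ℕ) → 0 < x i}
  is_open' := by
    have h : {x : EuclideanSpace ℝ (Fin N) | ∀ i : Fin N, N - k ≤ (i : ℕ) → 0 < x i} =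
        ⋂ i : Fin N, {x | N - k ≤ (i : ℕ) → 0 < x i} := by
      ext x; simp
    rw [h]
    refine isOpen_iInter_of_finite fun i => ?_
    by_cases hi : N - k ≤ (i : ℕ)
    · simp only [hi, true_imp_iff]
      exact isOpen_lt continuous_const (by fun_prop)
    · simp [hi]

/-- Lebesgue measure on `ℝ^{N-k} × (0,∞)^k`. -/
abbrev orthantVolume (N k : ℕ) : Measure (EuclideanSpace ℝ (Fin N)) :=
  volume.restrict (orthant N k : Set (EuclideanSpace ℝ (Fin N)))

/-- The Hardy constant `((N-2)/2 + k)^2`. -/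
def hardyConst (N k : ℕ) : ℝ := (((N : ℝ) - 2) / 2 + k) ^ 2

/-- The quadratic form `∫ (|∇v|² - lam |v|² / |x|² + |x|² |v|² / 16) dx` over `orthant N k`. -/
def energy (N k : ℕ) (lam : ℝ) (v : EuclideanSpace ℝ (Fin N) → ℝ) : ℝ :=
  ∫ x, (‖∇ v x‖ ^ 2 - lam / ‖x‖ ^ 2 * |v x| ^ 2 + ‖x‖ ^ 2 / 16 * |v x| ^ 2) ∂orthantVolume N k

/-- The symmetric bilinear form whose quadratic form is `energy`. -/
def bilin (N k : ℕ) (lam : ℝ) (v w : EuclideanSpace ℝ (Fin N) → ℝ) : ℝ :=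
  ∫ x, (inner ℝ (∇ v x) (∇ w x) - lam / ‖x‖ ^ 2 * (v x * w x) + ‖x‖ ^ 2 / 16 * (v x * w x))
    ∂orthantVolume N k

variable {N k : ℕ} {lam : ℝ}

lemma integrable_singular_mul {v w : 𝓓(orthant N k, ℝ)}
    (hv : Integrable (fun x => lam / ‖x‖ ^ 2 * |v x| ^ 2) (orthantVolume N k))
    (hw : Integrable (fun x => lam / ‖x‖ ^ 2 * |w x| ^ 2) (orthantVolume N k)) :
    Integrable (fun x => lam / ‖x‖ ^ 2 * (v x * w x)) (orthantVolume N k) := by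
  refine (hv.norm.add hw.norm).mono' ?_ ?_
  · have h1 : Measurable (v : EuclideanSpace ℝ (Fin N) → ℝ) := v.continuous.measurable
    have h2 : Measurable (w : EuclideanSpace ℝ (Fin N) → ℝ) := w.continuous.measurable
    exact Measurable.aestronglyMeasurable (by fun_prop)
  · refine Filter.Eventually.of_forall fun x => ?_
    simp only [Pi.add_apply, Real.norm_eq_abs, abs_mul, abs_pow, abs_abs]
    have h0 : 0 ≤ |lam / ‖x‖ ^ 2| := abs_nonneg _
    nlinarith [mul_nonneg h0 (sq_nonneg (|v x| - |w x|)),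
      mul_nonneg h0 (add_nonneg (sq_nonneg |v x|) (sq_nonneg |w x|))]

/-- The real test functions `v ∈ C_c^∞(ℝ^{N-k} × (0,∞)^k)` for which the singular term
`∫ lam |v|² / |x|²` of the form converges. This is every test function, except in the
case `N = 2`, `k = 0`, `lam ≠ 0` (see `formCore_eq_top`). -/
def formCore (N k : ℕ) (lam : ℝ) : Submodule ℝ 𝓓(orthant N k, ℝ) where
  carrier := {v | Integrable (fun x => lam / ‖x‖ ^ 2 * |v x| ^ 2) (orthantVolume N k)}
  zero_mem' := by simp
  add_mem' := by
    intro v w hv hw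
    have h := (Integrable.add hv ((integrable_singular_mul hv hw).const_mul 2)).add hw
    refine h.congr (Filter.Eventually.of_forall fun x => ?_)
    simp only [Pi.add_apply, FunLike.coe_add, sq_abs]
    ring
  smul_mem' := by
    intro c v hv
    refine (Integrable.const_mul hv (c ^ 2)).congr (Filter.Eventually.of_forall fun x => ?_)
    simp only [FunLike.coe_smul, Pi.smul_apply, smul_eq_mul, sq_abs]
    ring

lemma formCore_eq_top (hN : 2 ≤ N) (hk : k ≤ N) (h : N ≠ 2 ∨ k ≠ 0 ∨ lam = 0) :
    formCore N k lam = ⊤ := by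
  refine eq_top_iff.2 fun v _ => ?_
  change Integrable (fun x => lam / ‖x‖ ^ 2 * |v x| ^ 2) (orthantVolume N k)
  by_cases hlam : lam = 0
  · simp [hlam]
  have hvm : Measurable (v : EuclideanSpace ℝ (Fin N) → ℝ) := v.continuous.measurable
  have hcs : HasCompactSupport (fun x => lam / ‖x‖ ^ 2 * |v x| ^ 2) := by
    have h1 : HasCompactSupport (v : EuclideanSpace ℝ (Fin N) → ℝ) := v.hasCompactSupport
    refine h1.mono fun x hx => ?_
    simp only [Function.mem_support] at hx ⊢
    intro h0; exact hx (by simp [h0])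
  refine Integrable.restrict ?_
  by_cases hk0 : k = 0
  · have hN3 : 3 ≤ N := by
      rcases h with h | h | h
      · omega
      · exact absurd hk0 h
      · exact absurd h hlam
    obtain ⟨C, hC⟩ := v.continuous.bounded_above_of_compact_support v.hasCompactSupport
    obtain ⟨R, hR⟩ := hcs.isBounded.subset_ball (0 : EuclideanSpace ℝ (Fin N))
    have hfr : Module.finrank ℝ (EuclideanSpace ℝ (Fin N)) = N := by simp
    have hball : IntegrableOn (fun x => lam / ‖x‖ ^ 2 * |v x| ^ 2)
        (Metric.ball (0 : EuclideanSpace ℝ (Fin N)) R) volume := by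
      refine integrableOn_ball_of_norm_le_rpow (C := |lam| * C ^ 2) (α := 2) ?_ ?_ ?_ ?_
      · rw [hfr]; omega
      · rw [hfr]; exact_mod_cast hN3
      · refine Filter.Eventually.of_forall fun x => ?_
        have hCx : |v x| ^ 2 ≤ C ^ 2 := by
          have := hC x
          rw [Real.norm_eq_abs] at this
          gcongr
        rw [Real.rpow_neg (norm_nonneg x), Real.norm_eq_abs, abs_mul, abs_div]
        simp only [abs_pow, abs_abs, abs_norm]
        have h2 : ‖x‖ ^ (2 : ℝ) = ‖x‖ ^ 2 := by norm_cast
        rw [h2]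
        calc |lam| / ‖x‖ ^ 2 * |v x| ^ 2 ≤ |lam| / ‖x‖ ^ 2 * C ^ 2 := by gcongr
          _ = |lam| * C ^ 2 * (‖x‖ ^ 2)⁻¹ := by ring
      · exact Measurable.aestronglyMeasurable (by fun_prop)
    exact (integrableOn_iff_integrable_of_support_subset
      ((subset_tsupport _).trans hR)).1 hball
  · have hz : (0 : EuclideanSpace ℝ (Fin N)) ∉ tsupport (v : EuclideanSpace ℝ (Fin N) → ℝ) := by
      intro h0
      have h1 := v.tsupport_subset h0
      have h2 := h1 ⟨N - 1, by omega⟩ (by simp only; omega)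
      simp at h2
    refine Continuous.integrable_of_hasCompactSupport ?_ hcs
    refine continuous_iff_continuousAt.2 fun x => ?_
    by_cases hx : x = 0
    · have hev : (fun x => lam / ‖x‖ ^ 2 * |v x| ^ 2) =ᶠ[nhds x] fun _ => 0 := by
        rw [hx]
        filter_upwards [notMem_tsupport_iff_eventuallyEq.1 hz] with y hy
        rw [hy]
        simp
      exact hev.continuousAt
    · have hx2 : ‖x‖ ^ 2 ≠ 0 := by simpa using hx
      have hvc : Continuous (v : EuclideanSpace ℝ (Fin N) → ℝ) := v.continuous
      fun_prop (disch := assumption)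

lemma continuous_gradient (v : 𝓓(orthant N k, ℝ)) : Continuous (∇ v) := by
  have h : Continuous (fderiv ℝ (v : EuclideanSpace ℝ (Fin N) → ℝ)) :=
    v.contDiff.continuous_fderiv (by simp)
  exact (InnerProductSpace.toDual ℝ (EuclideanSpace ℝ (Fin N))).symm.continuous.comp h

lemma hasCompactSupport_gradient (v : 𝓓(orthant N k, ℝ)) : HasCompactSupport (∇ v) := by
  have h : HasCompactSupport (v : EuclideanSpace ℝ (Fin N) → ℝ) := v.hasCompactSupport
  exact (h.fderiv (𝕜 := ℝ)).comp_left (map_zero _)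

lemma gradient_add (v w : 𝓓(orthant N k, ℝ)) (x : EuclideanSpace ℝ (Fin N)) :
    ∇ (v + w : 𝓓(orthant N k, ℝ)) x = ∇ v x + ∇ w x := by
  have hv : DifferentiableAt ℝ (v : EuclideanSpace ℝ (Fin N) → ℝ) x :=
    (v.contDiff.differentiable (by simp)) x
  have hw : DifferentiableAt ℝ (w : EuclideanSpace ℝ (Fin N) → ℝ) x :=
    (w.contDiff.differentiable (by simp)) x
  simp only [gradient, FunLike.coe_add, fderiv_add hv hw, map_add]

lemma gradient_smul (c : ℝ) (v : 𝓓(orthant N k, ℝ)) (x : EuclideanSpace ℝ (Fin N)) :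
    ∇ (c • v : 𝓓(orthant N k, ℝ)) x = c • ∇ v x := by
  have hv : DifferentiableAt ℝ (v : EuclideanSpace ℝ (Fin N) → ℝ) x :=
    (v.contDiff.differentiable (by simp)) x
  simp only [gradient, FunLike.coe_smul, fderiv_const_smul hv, map_smulₛₗ]
  simp

lemma integrable_bilin {v w : 𝓓(orthant N k, ℝ)} (hv : v ∈ formCore N k lam)
    (hw : w ∈ formCore N k lam) :
    Integrable (fun x => inner ℝ (∇ v x) (∇ w x) - lam / ‖x‖ ^ 2 * (v x * w x)
      + ‖x‖ ^ 2 / 16 * (v x * w x)) (orthantVolume N k) := by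
  refine ((Integrable.restrict ?_).sub (integrable_singular_mul hv hw)).add
    (Integrable.restrict ?_)
  · refine Continuous.integrable_of_hasCompactSupport
      ((continuous_gradient v).inner (continuous_gradient w)) ?_
    refine (hasCompactSupport_gradient v).mono fun x hx => ?_
    simp only [Function.mem_support] at hx ⊢
    intro h0; exact hx (by simp [h0])
  · have hvc : Continuous (v : EuclideanSpace ℝ (Fin N) → ℝ) := v.continuous
    have hwc : Continuous (w : EuclideanSpace ℝ (Fin N) → ℝ) := w.continuous
    refine Continuous.integrable_of_hasCompactSupport (by fun_prop) ?_
    have h1 : HasCompactSupport (v : EuclideanSpace ℝ (Fin N) → ℝ) := v.hasCompactSupport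
    refine h1.mono fun x hx => ?_
    simp only [Function.mem_support] at hx ⊢
    intro h0; exact hx (by simp [h0])

lemma bilin_self (v : EuclideanSpace ℝ (Fin N) → ℝ) : bilin N k lam v v = energy N k lam v := by
  simp only [bilin, energy, real_inner_self_eq_norm_sq, sq_abs, ← sq]

/-- Nonnegativity of the quadratic form on its core; it is what makes `√energy` a seminorm. -/
def EnergyNonneg (N k : ℕ) (lam : ℝ) : Prop :=
  ∀ v : formCore N k lam, 0 ≤ energy N k lam v.1

/-- The vector space `formCore N k lam`, to be endowed with the norm `‖v‖ = √(energy v)`. -/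
def PreFormDomain (N k : ℕ) (lam : ℝ) (_ : EnergyNonneg N k lam) : Type := formCore N k lam

variable {hpos : EnergyNonneg N k lam}

/-- The test function underlying an element of `PreFormDomain`. -/
def PreFormDomain.toTest (v : PreFormDomain N k lam hpos) : 𝓓(orthant N k, ℝ) := Subtype.val v

lemma PreFormDomain.toTest_mem (v : PreFormDomain N k lam hpos) :
    v.toTest ∈ formCore N k lam := Subtype.property v

instance : AddCommGroup (PreFormDomain N k lam hpos) :=
  inferInstanceAs (AddCommGroup (formCore N k lam))

instance : Module ℝ (PreFormDomain N k lam hpos) :=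
  inferInstanceAs (Module ℝ (formCore N k lam))

/-- The semi-inner product `bilin` on `PreFormDomain`. -/
@[reducible]
def PreFormDomain.core : PreInnerProductSpace.Core ℝ (PreFormDomain N k lam hpos) where
  inner v w := bilin N k lam v.toTest w.toTest
  conj_inner_symm v w := by
    simp only [bilin, conj_trivial, real_inner_comm, mul_comm]
  re_inner_nonneg v := by
    rw [RCLike.re_to_real, bilin_self]
    exact hpos v
  add_left u v w := by
    simp only [bilin]
    rw [← integral_add (integrable_bilin u.toTest_mem w.toTest_mem)
      (integrable_bilin v.toTest_mem w.toTest_mem)]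
    refine integral_congr_ae (Filter.Eventually.of_forall fun x => ?_)
    have h1 : (u + v).toTest = u.toTest + v.toTest := rfl
    beta_reduce
    rw [h1, gradient_add]
    simp only [inner_add_left, FunLike.coe_add, Pi.add_apply]
    ring
  smul_left v w c := by
    simp only [bilin, conj_trivial]
    rw [← integral_const_mul]
    refine integral_congr_ae (Filter.Eventually.of_forall fun x => ?_)
    have h1 : (c • v).toTest = c • v.toTest := rfl
    beta_reduce
    rw [h1, gradient_smul]
    simp only [inner_smul_left, FunLike.coe_smul, Pi.smul_apply, smul_eq_mul,
      conj_trivial]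
    ring

instance : SeminormedAddCommGroup (PreFormDomain N k lam hpos) :=
  @InnerProductSpace.Core.toSeminormedAddCommGroup ℝ _ _ _ _ PreFormDomain.core

instance : InnerProductSpace ℝ (PreFormDomain N k lam hpos) :=
  InnerProductSpace.ofCore PreFormDomain.core

/-- The form domain: the Hilbert space obtained by completing the test functions with respect to
`‖v‖ = √(energy v)`. -/
abbrev FormDomain (N k : ℕ) (lam : ℝ) (hpos : EnergyNonneg N k lam) : Type :=
  UniformSpace.Completion (PreFormDomain N k lam hpos)

/-- The norm of the form domain, on test functions. -/
lemma norm_coe (v : PreFormDomain N k lam hpos) :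
    ‖(v : FormDomain N k lam hpos)‖ = √(energy N k lam v.toTest) := by
  rw [UniformSpace.Completion.norm_coe, ← bilin_self]
  rfl

end HardyForm

end

/-! ### Integration by parts on the orthant. -/

namespace HardyForm

variable {N k : ℕ} {lam : ℝ}

/-! Write `α = (N-2)/2 + k`. The function `φ(x) = ‖x‖^(-α) ∏ x_i`, with the product over the
positive coordinates, satisfies `-Δφ = α² φ / ‖x‖²`. Expanding the square and integrating by parts
therefore gives `∫ |∇v|² - α² ∫ v²/‖x‖² = ∫ |∇v - v ∇φ/φ|²` (`integral_norm_sq_flow`). The energy is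
thus a sum of three nonnegative terms: the square of `flow v = ∇v - v ∇φ/φ`, the gap `(α² - λ)
v²/‖x‖²` and the potential `‖x‖² v²/16` (`energy_eq`).

Since `φ` is homogeneous of degree `-(N-2)/2`, the weight `φ² dx` is radially that of dimension two.
Expanding `0 ≤ ∫ |flow v + v h(‖x‖²) x|²` gives a family of lower bounds
(`integral_radial_le_flow`). The choice `h = 1/4` bounds the `L²` norm by the energy. The choice
`h(s) = (s+e)^(-1/2)` bounds `∫ v² (‖x‖²+e)^(-1/2)` uniformly in `e`, so little mass sits near the
origin.

Compactness: at the critical `λ` the energy does not control `∫ |∇v|²`, so `v` is replaced by `u = v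
‖x‖²/(‖x‖²+e)`. This is close to `v` in `L²`, and its Dirichlet integral is bounded by a multiple,
depending on `e`, of the energy. A Poincaré inequality on the cells of a fine grid, with the
potential controlling the mass far away, bounds `∫ u²` by a small multiple of the energy plus
finitely many squared cell integrals (`exists_finset_integral_sq_le`). An operator with such an
estimate is compact (`isCompactOperator_of_estimate`).

Injectivity is closability of the form: an element of the completion could be nonzero and yet have
`L²` image zero. The components of `flow v` and the square roots of the other two terms extend to
bounded operators on the completion, and their squared norms add up to the squared norm. Each has an
adjoint on test functions supported away from the origin (`eq_zero_of_adjoint`), so each vanishes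
wherever the embedding does. -/

lemma gradient_coord (f : EuclideanSpace ℝ (Fin N) → ℝ) (x : EuclideanSpace ℝ (Fin N))
    (i : Fin N) : ∇ f x i = fderiv ℝ f x (EuclideanSpace.single i 1) := by
  rw [← inner_gradient_left, EuclideanSpace.inner_single_right]
  simp

lemma gradient_coord_of_hasFDerivAt {f : EuclideanSpace ℝ (Fin N) → ℝ}
    {f' : EuclideanSpace ℝ (Fin N) →L[ℝ] ℝ} {x : EuclideanSpace ℝ (Fin N)}
    (h : HasFDerivAt f f' x) (i : Fin N) : ∇ f x i = f' (EuclideanSpace.single i 1) := by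
  rw [gradient_coord, h.fderiv]

lemma measurableSet_orthant : MeasurableSet (orthant N k : Set (EuclideanSpace ℝ (Fin N))) :=
  (orthant N k).isOpen.measurableSet

/-- Admits coefficients such as `(x i)⁻¹`, singular on the boundary of `U`: the product is locally
zero off the support of `f`. -/
lemma continuous_mul_of_continuousOn {X : Type*} [TopologicalSpace X] {U : Set X} (hU : IsOpen U)
    {f g : X → ℝ} (hf : Continuous f) (hs : tsupport f ⊆ U) (hg : ContinuousOn g U) :
    Continuous (fun x => f x * g x) := by
  refine continuous_iff_continuousAt.2 fun x => ?_
  by_cases hx : x ∈ tsupport f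
  · exact hf.continuousAt.mul (hg.continuousAt (hU.mem_nhds (hs hx)))
  · have hev : (fun x => f x * g x) =ᶠ[nhds x] fun _ => 0 := by
      filter_upwards [notMem_tsupport_iff_eventuallyEq.1 hx] with y hy
      simp [hy]
    exact hev.continuousAt

lemma integrable_mul_of_continuousOn {f g : EuclideanSpace ℝ (Fin N) → ℝ}
    (hf : Continuous f) (hc : HasCompactSupport f) (hs : tsupport f ⊆ orthant N k)
    (hg : ContinuousOn g (orthant N k)) : Integrable (fun x => f x * g x) :=
  (continuous_mul_of_continuousOn (orthant N k).isOpen hf hs hg).integrable_of_hasCompactSupport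
    hc.mul_right

/-- Integration by parts on the orthant. -/
lemma integral_coord_gradient_mul {f g : EuclideanSpace ℝ (Fin N) → ℝ}
    (hf : ContDiff ℝ 1 f) (hc : HasCompactSupport f) (hs : tsupport f ⊆ orthant N k)
    (hg : ContDiffOn ℝ 1 g (orthant N k)) (i : Fin N) :
    Integrable (fun x => ∇ f x i * g x) (orthantVolume N k) ∧
    Integrable (fun x => f x * ∇ g x i) (orthantVolume N k) ∧
    ∫ x, ∇ f x i * g x ∂orthantVolume N k = - ∫ x, f x * ∇ g x i ∂orthantVolume N k := by
  have ho : IsOpen (orthant N k : Set (EuclideanSpace ℝ (Fin N))) := (orthant N k).isOpen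
  simp only [gradient_coord]
  have hts : tsupport (fun x => fderiv ℝ f x (EuclideanSpace.single i 1)) ⊆ tsupport f :=
    (closure_mono (fun x hx => by
      simp only [Function.mem_support] at hx ⊢
      intro h0; exact hx (by simp [h0]))).trans (tsupport_fderiv_subset ℝ (f := f))
  have h1 : Integrable (fun x => fderiv ℝ f x (EuclideanSpace.single i 1) * g x) :=
    integrable_mul_of_continuousOn ((hf.continuous_fderiv (by simp)).clm_apply continuous_const)
      (hc.of_isClosed_subset (isClosed_tsupport _) hts) (hts.trans hs) hg.continuousOn
  have h2 : Integrable (fun x => f x * fderiv ℝ g x (EuclideanSpace.single i 1)) :=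
    integrable_mul_of_continuousOn hf.continuous hc hs
      ((hg.continuousOn_fderiv_of_isOpen ho le_rfl).clm_apply continuousOn_const)
  have h3 : Integrable (fun x => f x * g x) :=
    integrable_mul_of_continuousOn hf.continuous hc hs hg.continuousOn
  refine ⟨h1.restrict, h2.restrict, ?_⟩
  have key := integral_mul_fderiv_eq_neg_fderiv_mul_of_integrable h1 h2 h3
    (fun x _ => hf.differentiable (by simp) x)
    (fun x hx => (hg.contDiffAt (ho.mem_nhds (hs hx))).differentiableAt (by simp))
  have hz : ∀ x, x ∉ (orthant N k : Set (EuclideanSpace ℝ (Fin N))) → x ∉ tsupport f :=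
    fun x hx h => hx (hs h)
  rw [setIntegral_eq_integral_of_forall_compl_eq_zero, setIntegral_eq_integral_of_forall_compl_eq_zero,
    key, neg_neg]
  · intro x hx
    simp [image_eq_zero_of_notMem_tsupport (hz x hx)]
  · intro x hx
    have := image_eq_zero_of_notMem_tsupport (fun h => hz x hx (hts h))
    simp [this]

lemma contDiff_test (v : 𝓓(orthant N k, ℝ)) : ContDiff ℝ 1 v :=
  v.contDiff.of_le (by simp)

lemma differentiable_test (v : 𝓓(orthant N k, ℝ)) : Differentiable ℝ v :=
  (contDiff_test v).differentiable (by simp)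

lemma tsupport_sq_subset (v : 𝓓(orthant N k, ℝ)) :
    tsupport (fun x => v x ^ 2) ⊆ orthant N k :=
  (closure_mono (fun x hx => by
    simp only [Function.mem_support] at hx ⊢
    intro h0; exact hx (by simp [h0]))).trans v.tsupport_subset

lemma hasCompactSupport_sq (v : 𝓓(orthant N k, ℝ)) : HasCompactSupport (fun x => v x ^ 2) :=
  v.hasCompactSupport.mono (fun x hx => by
    simp only [Function.mem_support] at hx ⊢
    intro h0; exact hx (by simp [h0]))

/-- Integration by parts against the square of a test function. -/
lemma integral_sq_mul (v : 𝓓(orthant N k, ℝ)) {g : EuclideanSpace ℝ (Fin N) → ℝ}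
    (hg : ContDiffOn ℝ 1 g (orthant N k)) (i : Fin N) :
    Integrable (fun x => 2 * v x * ∇ v x i * g x) (orthantVolume N k) ∧
    Integrable (fun x => v x ^ 2 * ∇ g x i) (orthantVolume N k) ∧
    ∫ x, 2 * v x * ∇ v x i * g x ∂orthantVolume N k
      = - ∫ x, v x ^ 2 * ∇ g x i ∂orthantVolume N k := by
  have hgr : ∀ x, ∇ (fun x => v x ^ 2) x i = 2 * v x * ∇ v x i := fun x => by
    rw [gradient_coord_of_hasFDerivAt ((differentiable_test v x).hasFDerivAt.pow 2),
      gradient_coord]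
    simp
  have := integral_coord_gradient_mul ((contDiff_test v).pow 2) (hasCompactSupport_sq v)
    (tsupport_sq_subset v) hg i
  simpa only [hgr] using this

lemma integrable_sq_mul (v : 𝓓(orthant N k, ℝ)) {g : EuclideanSpace ℝ (Fin N) → ℝ}
    (hg : ContinuousOn g (orthant N k)) :
    Integrable (fun x => v x ^ 2 * g x) (orthantVolume N k) :=
  (integrable_mul_of_continuousOn (v.continuous.pow 2) (hasCompactSupport_sq v)
    (tsupport_sq_subset v) hg).restrict

lemma inner_eq_sum_coord (x y : EuclideanSpace ℝ (Fin N)) : inner ℝ x y = ∑ i, x i * y i := by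
  simp [PiLp.inner_apply, mul_comm]

lemma norm_sq_eq_sum_coord (x : EuclideanSpace ℝ (Fin N)) : ‖x‖ ^ 2 = ∑ i, x i ^ 2 := by
  simp [EuclideanSpace.norm_sq_eq]

/-- Integration by parts against a radial vector field `x ↦ h (‖x‖ ^ 2) • x`. -/
lemma integral_radial (v : 𝓓(orthant N k, ℝ)) {h : ℝ → ℝ}
    (hh : ∀ s, 0 ≤ s → ContDiffAt ℝ 1 h s) :
    Integrable (fun x => 2 * v x * inner ℝ (∇ v x) x * h (‖x‖ ^ 2)) (orthantVolume N k) ∧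
    Integrable (fun x => v x ^ 2 * (N * h (‖x‖ ^ 2) + 2 * ‖x‖ ^ 2 * deriv h (‖x‖ ^ 2)))
      (orthantVolume N k) ∧
    ∫ x, 2 * v x * inner ℝ (∇ v x) x * h (‖x‖ ^ 2) ∂orthantVolume N k =
      - ∫ x, v x ^ 2 * (N * h (‖x‖ ^ 2) + 2 * ‖x‖ ^ 2 * deriv h (‖x‖ ^ 2))
        ∂orthantVolume N k := by
  -- Taking `‖x‖ ^ 2` rather than `‖x‖` as the argument of `h` keeps the vector field `C¹` across
  -- the origin.
  have hcd : ContDiff ℝ 1 (fun x : EuclideanSpace ℝ (Fin N) => h (‖x‖ ^ 2)) :=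
    contDiff_iff_contDiffAt.2 fun x =>
      (hh _ (sq_nonneg _)).comp x (contDiff_norm_sq ℝ).contDiffAt
  have hgr : ∀ i x, ∇ (fun x : EuclideanSpace ℝ (Fin N) => x i * h (‖x‖ ^ 2)) x i =
      h (‖x‖ ^ 2) + 2 * x i ^ 2 * deriv h (‖x‖ ^ 2) := fun i x => by
    have h1 : HasFDerivAt (fun x : EuclideanSpace ℝ (Fin N) => x i)
        (EuclideanSpace.proj i : EuclideanSpace ℝ (Fin N) →L[ℝ] ℝ) x :=
      (EuclideanSpace.proj i : EuclideanSpace ℝ (Fin N) →L[ℝ] ℝ).hasFDerivAt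
    have h2 : HasFDerivAt (fun x : EuclideanSpace ℝ (Fin N) => h (‖x‖ ^ 2))
        (deriv h (‖x‖ ^ 2) • (2 • innerSL ℝ x)) x :=
      ((hh _ (sq_nonneg ‖x‖)).differentiableAt (by simp)).hasDerivAt.comp_hasFDerivAt x
        (hasStrictFDerivAt_norm_sq x).hasFDerivAt
    refine (gradient_coord_of_hasFDerivAt (h1.mul h2) i).trans ?_
    simp [EuclideanSpace.inner_single_right]
    ring
  have key := fun i : Fin N => integral_sq_mul v (k := k)
    (g := fun x => x i * h (‖x‖ ^ 2)) (by
      refine ContDiff.contDiffOn (ContDiff.mul ?_ hcd)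
      exact (EuclideanSpace.proj i : EuclideanSpace ℝ (Fin N) →L[ℝ] ℝ).contDiff) i
  simp only [hgr] at key
  have e1 : ∀ x, 2 * v x * inner ℝ (∇ v x) x * h (‖x‖ ^ 2) =
      ∑ i, 2 * v x * ∇ v x i * (x i * h (‖x‖ ^ 2)) := fun x => by
    rw [inner_eq_sum_coord, Finset.mul_sum, Finset.sum_mul]
    exact Finset.sum_congr rfl fun i _ => by ring
  have e2 : ∀ x, v x ^ 2 * (N * h (‖x‖ ^ 2) + 2 * ‖x‖ ^ 2 * deriv h (‖x‖ ^ 2)) =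
      ∑ i, v x ^ 2 * (h (‖x‖ ^ 2) + 2 * x i ^ 2 * deriv h (‖x‖ ^ 2)) := fun x => by
    rw [← Finset.mul_sum, Finset.sum_add_distrib, ← Finset.sum_mul, ← Finset.mul_sum,
      ← norm_sq_eq_sum_coord]
    simp
  simp only [e1, e2]
  refine ⟨integrable_finsetSum _ fun i _ => (key i).1,
    integrable_finsetSum _ fun i _ => (key i).2.1, ?_⟩
  rw [integral_finsetSum _ fun i _ => (key i).1, integral_finsetSum _ fun i _ => (key i).2.1,
    ← Finset.sum_neg_distrib]
  exact Finset.sum_congr rfl fun i _ => (key i).2.2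

/-- Integration by parts against `x ↦ (x i)⁻¹` for a coordinate that is positive on the orthant. -/
lemma integral_inv_coord (v : 𝓓(orthant N k, ℝ)) {i : Fin N} (hi : N - k ≤ (i : ℕ)) :
    Integrable (fun x => 2 * v x * ∇ v x i * (x i)⁻¹) (orthantVolume N k) ∧
    Integrable (fun x => v x ^ 2 * ((x i)⁻¹) ^ 2) (orthantVolume N k) ∧
    ∫ x, 2 * v x * ∇ v x i * (x i)⁻¹ ∂orthantVolume N k
      = ∫ x, v x ^ 2 * ((x i)⁻¹) ^ 2 ∂orthantVolume N k := by
  have hne : ∀ x ∈ (orthant N k : Set (EuclideanSpace ℝ (Fin N))), x i ≠ 0 :=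
    fun x hx => (hx i hi).ne'
  have hgr : ∀ x ∈ (orthant N k : Set (EuclideanSpace ℝ (Fin N))),
      ∇ (fun x : EuclideanSpace ℝ (Fin N) => (x i)⁻¹) x i = - ((x i)⁻¹) ^ 2 := fun x hx => by
    have h1 : HasFDerivAt (fun x : EuclideanSpace ℝ (Fin N) => x i)
        (EuclideanSpace.proj i : EuclideanSpace ℝ (Fin N) →L[ℝ] ℝ) x :=
      (EuclideanSpace.proj i : EuclideanSpace ℝ (Fin N) →L[ℝ] ℝ).hasFDerivAt
    refine (gradient_coord_of_hasFDerivAt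
      ((hasDerivAt_inv (hne x hx)).comp_hasFDerivAt x h1) i).trans ?_
    simp
  obtain ⟨a, b, c⟩ := integral_sq_mul v (k := k) (g := fun x => (x i)⁻¹) (by
    refine ContDiffOn.inv ?_ hne
    exact (EuclideanSpace.proj i : EuclideanSpace ℝ (Fin N) →L[ℝ] ℝ).contDiff.contDiffOn) i
  have hae : (fun x => v x ^ 2 * ∇ (fun x : EuclideanSpace ℝ (Fin N) => (x i)⁻¹) x i)
      =ᵐ[orthantVolume N k] fun x => - (v x ^ 2 * ((x i)⁻¹) ^ 2) := by
    filter_upwards [ae_restrict_mem measurableSet_orthant] with x hx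
    rw [hgr x hx]; ring
  refine ⟨a, ?_, ?_⟩
  · simpa using (b.congr hae).neg
  · rw [c, integral_congr_ae hae, integral_neg, neg_neg]

end HardyForm

/-! ### The ground state representation and radial lower bounds. -/

namespace HardyForm

variable {N k : ℕ} {lam : ℝ}

/-- The square root `(N - 2) / 2 + k` of the Hardy constant. -/
noncomputable def hardyRoot (N k : ℕ) : ℝ := ((N : ℝ) - 2) / 2 + k

lemma hardyRoot_sq : hardyRoot N k ^ 2 = hardyConst N k := rfl

lemma ae_mem_orthant_and_ne_zero (hN : 2 ≤ N) :
    ∀ᵐ x ∂orthantVolume N k, x ∈ (orthant N k : Set (EuclideanSpace ℝ (Fin N))) ∧ x ≠ 0 := by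
  have : Nonempty (Fin N) := ⟨⟨0, by omega⟩⟩
  refine (ae_restrict_mem measurableSet_orthant).and (ae_restrict_of_ae ?_)
  simp [ae_iff]

/-- The second alternative has the form of the hypothesis of `formCore_eq_top` with `lam = 1`, which
yields integrability of `v²/‖x‖²`. -/
lemma hardyRoot_eq_zero_or : hardyRoot N k = 0 ∨ (N ≠ 2 ∨ k ≠ 0 ∨ (1 : ℝ) = 0) := by
  by_cases h : N = 2 ∧ k = 0
  · left; simp [hardyRoot, h.1, h.2]
  · right; tauto

lemma integrable_gradient_sq (v : 𝓓(orthant N k, ℝ)) :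
    Integrable (fun x => ‖∇ v x‖ ^ 2) (orthantVolume N k) := by
  refine Integrable.restrict (Continuous.integrable_of_hasCompactSupport
    ((continuous_gradient v).norm.pow 2) ?_)
  refine (hasCompactSupport_gradient v).mono fun x hx => ?_
  simp only [Function.mem_support] at hx ⊢
  intro h0; exact hx (by simp [h0])

/-- The field `x/‖x‖²` is singular at the origin, so `integral_radial` is applied to `x/(‖x‖²+e)`
and `e` tends to zero by dominated convergence. The divergence tends to `N/‖x‖² - 2/‖x‖² =
(N-2)/‖x‖²`. -/
lemma integral_inner_inv_norm_sq_aux (hN : 2 ≤ N) (v : 𝓓(orthant N k, ℝ))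
    (hv : Integrable (fun x => v x ^ 2 * (‖x‖ ^ 2)⁻¹) (orthantVolume N k)) :
    Integrable (fun x => 2 * v x * inner ℝ (∇ v x) x * (‖x‖ ^ 2)⁻¹) (orthantVolume N k) ∧
    ∫ x, 2 * v x * inner ℝ (∇ v x) x * (‖x‖ ^ 2)⁻¹ ∂orthantVolume N k =
      - ((N - 2) * ∫ x, v x ^ 2 * (‖x‖ ^ 2)⁻¹ ∂orthantVolume N k) := by
  have hvm : Measurable (v : EuclideanSpace ℝ (Fin N) → ℝ) := v.continuous.measurable
  have hgm : Measurable (fun x => inner ℝ (∇ v x) x) :=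
    ((continuous_gradient v).inner continuous_id).measurable
  let e : ℕ → ℝ := fun n => 1 / ((n : ℝ) + 1)
  have he : ∀ n, 0 < e n := fun n => by positivity
  have he0 : Filter.Tendsto e Filter.atTop (nhds 0) := tendsto_one_div_add_atTop_nhds_zero_nat
  let h : ℕ → ℝ → ℝ := fun n s => (s + e n)⁻¹
  have hd : ∀ n s, 0 ≤ s → HasDerivAt (h n) (-((s + e n) ^ 2)⁻¹) s := fun n s hs => by
    have := he n
    refine (((hasDerivAt_id s).add_const (e n)).inv (by simp only [id]; positivity)).congr_deriv ?_
    simp [neg_div]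
  have key := fun n => integral_radial v (h := h n) (fun s hs => by
    refine ContDiffAt.inv (by fun_prop) ?_
    have := he n; positivity)
  have hder : ∀ n (x : EuclideanSpace ℝ (Fin N)), deriv (h n) (‖x‖ ^ 2)
      = -((‖x‖ ^ 2 + e n) ^ 2)⁻¹ := fun n x => (hd n _ (sq_nonneg _)).deriv
  simp only [hder] at key
  have hinv : ∀ s : ℝ, s ≠ 0 → Filter.Tendsto (fun n => (s + e n)⁻¹) Filter.atTop (nhds s⁻¹) :=
    fun s hs => by
      have : Filter.Tendsto (fun n => s + e n) Filter.atTop (nhds s) := by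
        simpa using he0.const_add s
      exact this.inv₀ hs
  have hG : Integrable (fun x => ‖∇ v x‖ ^ 2 + v x ^ 2 * (‖x‖ ^ 2)⁻¹) (orthantVolume N k) :=
    (integrable_gradient_sq v).add hv
  -- One bound for every weight `a` up to `‖x‖⁻²`, so that it dominates the limit and all the
  -- approximants.
  have hbound : ∀ (x : EuclideanSpace ℝ (Fin N)) (a : ℝ), x ≠ 0 → 0 ≤ a → a ≤ (‖x‖ ^ 2)⁻¹ →
      ‖2 * v x * inner ℝ (∇ v x) x * a‖ ≤ ‖∇ v x‖ ^ 2 + v x ^ 2 * (‖x‖ ^ 2)⁻¹ := by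
    intro x a hx ha hle
    have hr : 0 < ‖x‖ := norm_pos_iff.2 hx
    have h1 := abs_real_inner_le_norm (∇ v x) x
    rw [Real.norm_eq_abs, abs_mul, abs_mul, abs_mul, abs_of_nonneg ha, abs_two]
    calc 2 * |v x| * |inner ℝ (∇ v x) x| * a
        ≤ 2 * |v x| * (‖∇ v x‖ * ‖x‖) * (‖x‖ ^ 2)⁻¹ := by gcongr
      _ = 2 * ‖∇ v x‖ * (|v x| * ‖x‖⁻¹) := by field_simp
      _ ≤ ‖∇ v x‖ ^ 2 + (|v x| * ‖x‖⁻¹) ^ 2 := two_mul_le_add_sq _ _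
      _ = _ := by rw [mul_pow, sq_abs, inv_pow]
  have hle : ∀ n (x : EuclideanSpace ℝ (Fin N)), x ≠ 0 → (‖x‖ ^ 2 + e n)⁻¹ ≤ (‖x‖ ^ 2)⁻¹ :=
    fun n x hx => by
      have hr : 0 < ‖x‖ := norm_pos_iff.2 hx
      have := (he n).le
      gcongr; linarith
  have hae := ae_mem_orthant_and_ne_zero (k := k) hN
  have hi : Integrable (fun x => 2 * v x * inner ℝ (∇ v x) x * (‖x‖ ^ 2)⁻¹)
      (orthantVolume N k) := by
    refine hG.mono' (Measurable.aestronglyMeasurable (by fun_prop)) ?_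
    filter_upwards [hae] with x hx
    exact hbound x _ hx.2 (by positivity) le_rfl
  refine ⟨hi, ?_⟩
  have t1 : Filter.Tendsto (fun n => ∫ x, 2 * v x * inner ℝ (∇ v x) x * h n (‖x‖ ^ 2)
      ∂orthantVolume N k) Filter.atTop
      (nhds (∫ x, 2 * v x * inner ℝ (∇ v x) x * (‖x‖ ^ 2)⁻¹ ∂orthantVolume N k)) := by
    refine tendsto_integral_of_dominated_convergence
      (fun x => ‖∇ v x‖ ^ 2 + v x ^ 2 * (‖x‖ ^ 2)⁻¹) (fun n => (key n).1.1) hG (fun n => ?_) ?_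
    · filter_upwards [hae] with x hx
      have := he n
      exact hbound x _ hx.2 (by positivity) (hle n x hx.2)
    · filter_upwards [hae] with x hx
      exact (hinv _ (by simpa using hx.2)).const_mul _
  have t2 : Filter.Tendsto (fun n => ∫ x, v x ^ 2 * (N * h n (‖x‖ ^ 2)
      + 2 * ‖x‖ ^ 2 * -((‖x‖ ^ 2 + e n) ^ 2)⁻¹) ∂orthantVolume N k) Filter.atTop
      (nhds (∫ x, (N - 2) * (v x ^ 2 * (‖x‖ ^ 2)⁻¹) ∂orthantVolume N k)) := by
    refine tendsto_integral_of_dominated_convergence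
      (fun x => (N + 2) * (v x ^ 2 * (‖x‖ ^ 2)⁻¹)) (fun n => (key n).2.1.1) (hv.const_mul _)
      (fun n => ?_) ?_
    · filter_upwards [hae] with x hx
      have hr : 0 < ‖x‖ := norm_pos_iff.2 hx.2
      have h1 := hle n x hx.2
      have h2 := he n
      have h3 : ‖x‖ ^ 2 * ((‖x‖ ^ 2 + e n) ^ 2)⁻¹ ≤ (‖x‖ ^ 2)⁻¹ := by
        have : ((‖x‖ ^ 2 + e n) ^ 2)⁻¹ ≤ ((‖x‖ ^ 2) ^ 2)⁻¹ := by
          rw [← inv_pow, ← inv_pow]; gcongr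
        calc ‖x‖ ^ 2 * ((‖x‖ ^ 2 + e n) ^ 2)⁻¹ ≤ ‖x‖ ^ 2 * ((‖x‖ ^ 2) ^ 2)⁻¹ := by gcongr
          _ = _ := by field_simp
      have h4 : 0 ≤ ‖x‖ ^ 2 * ((‖x‖ ^ 2 + e n) ^ 2)⁻¹ := by positivity
      have h5 : (0 : ℝ) ≤ N * (‖x‖ ^ 2 + e n)⁻¹ := by positivity
      have h6 : (N : ℝ) * (‖x‖ ^ 2 + e n)⁻¹ ≤ N * (‖x‖ ^ 2)⁻¹ := by gcongr
      rw [norm_mul, Real.norm_of_nonneg (sq_nonneg _), ← mul_left_comm]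
      gcongr
      rw [Real.norm_eq_abs, abs_le]
      simp only [h]
      constructor <;> nlinarith
    · filter_upwards [hae] with x hx
      have hr : ‖x‖ ^ 2 ≠ 0 := by simpa using hx.2
      have := (((hinv _ hr).const_mul (N : ℝ)).add
        (((hinv _ hr).pow 2).neg.const_mul (2 * ‖x‖ ^ 2))).const_mul (v x ^ 2)
      simp only [← inv_pow]
      convert this using 2
      field_simp
      ring
  have t3 : Filter.Tendsto (fun n => ∫ x, 2 * v x * inner ℝ (∇ v x) x * h n (‖x‖ ^ 2)
      ∂orthantVolume N k) Filter.atTop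
      (nhds (-∫ x, (N - 2) * (v x ^ 2 * (‖x‖ ^ 2)⁻¹) ∂orthantVolume N k)) :=
    t2.neg.congr fun n => (key n).2.2.symm
  rw [tendsto_nhds_unique t1 t3, integral_const_mul]

/-- The factor `hardyRoot N k` stays inside the integrand because for `N = 2`, `k = 0` the function
`v²/‖x‖²` need not be integrable. Exactly then the factor is zero. -/
lemma integrable_hardyRoot_mul (hN : 2 ≤ N) (hk : k ≤ N) (v : 𝓓(orthant N k, ℝ)) :
    Integrable (fun x => hardyRoot N k * (v x ^ 2 * (‖x‖ ^ 2)⁻¹)) (orthantVolume N k) := by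
  rcases hardyRoot_eq_zero_or (N := N) (k := k) with h | h
  · simp [h]
  · have hv : v ∈ formCore N k 1 := by rw [formCore_eq_top hN hk h]; trivial
    refine Integrable.const_mul (Integrable.congr hv (.of_forall fun x => ?_)) _
    simp [mul_comm]

lemma integral_inner_inv_norm_sq (hN : 2 ≤ N) (hk : k ≤ N) (v : 𝓓(orthant N k, ℝ)) :
    Integrable (fun x => hardyRoot N k * (2 * v x * inner ℝ (∇ v x) x * (‖x‖ ^ 2)⁻¹))
      (orthantVolume N k) ∧
    ∫ x, hardyRoot N k * (2 * v x * inner ℝ (∇ v x) x * (‖x‖ ^ 2)⁻¹) ∂orthantVolume N k =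
      - ((N - 2) * ∫ x, hardyRoot N k * (v x ^ 2 * (‖x‖ ^ 2)⁻¹) ∂orthantVolume N k) := by
  by_cases h : hardyRoot N k = 0
  · simp [h]
  · have hv : Integrable (fun x => v x ^ 2 * (‖x‖ ^ 2)⁻¹) (orthantVolume N k) := by
      simpa [h] using (integrable_hardyRoot_mul hN hk v).const_mul (hardyRoot N k)⁻¹
    obtain ⟨a, b⟩ := integral_inner_inv_norm_sq_aux hN v hv
    refine ⟨a.const_mul _, ?_⟩
    rw [integral_const_mul, b, integral_const_mul]
    ring

/-- The logarithmic gradient of `x ↦ ‖x‖ ^ (-hardyRoot N k) * ∏ x i`, where the product is over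
the positive coordinates of the orthant. -/
noncomputable def groundField (N k : ℕ) (x : EuclideanSpace ℝ (Fin N)) : EuclideanSpace ℝ (Fin N) :=
  WithLp.toLp 2 fun i =>
    (if N - k ≤ (i : ℕ) then (x i)⁻¹ else 0) - hardyRoot N k * (‖x‖ ^ 2)⁻¹ * x i

/-- The gradient of `v` relative to the ground state, `∇ v - v • groundField`. -/
noncomputable def flow (N k : ℕ) (v : EuclideanSpace ℝ (Fin N) → ℝ) (x : EuclideanSpace ℝ (Fin N)) :
    EuclideanSpace ℝ (Fin N) :=
  ∇ v x - v x • groundField N k x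

lemma sum_coord_mul_inv (hk : k ≤ N) {x : EuclideanSpace ℝ (Fin N)} (hx : x ∈ orthant N k) :
    ∑ i : Fin N, x i * (if N - k ≤ (i : ℕ) then (x i)⁻¹ else 0) = k := by
  have h1 : ∀ i : Fin N, x i * (if N - k ≤ (i : ℕ) then (x i)⁻¹ else 0) =
      if N - k ≤ (i : ℕ) then 1 else 0 := fun i => by
    split_ifs with h
    · exact mul_inv_cancel₀ (hx i h).ne'
    · simp
  simp only [h1]
  rw [Fin.sum_univ_eq_sum_range (fun j => if N - k ≤ j then (1 : ℝ) else 0) N,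
    Finset.sum_ite, Finset.sum_const_zero, add_zero, Finset.sum_const, nsmul_eq_mul, mul_one]
  have : (Finset.range N).filter (fun j => N - k ≤ j) = Finset.Ico (N - k) N := by
    ext j; simp; omega
  rw [this, Nat.card_Ico]
  congr 1; omega

/-- Euler's identity for the logarithmic gradient of a function homogeneous of degree `k - hardyRoot
N k = -(N-2)/2`. -/
lemma inner_groundField (hk : k ≤ N) {x : EuclideanSpace ℝ (Fin N)} (hx : x ∈ orthant N k)
    (h0 : x ≠ 0) : inner ℝ (groundField N k x) x = -((N - 2) / 2) := by
  have hr : ‖x‖ ^ 2 ≠ 0 := by simpa using h0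
  have h1 : ∀ i, groundField N k x i * x i =
      x i * (if N - k ≤ (i : ℕ) then (x i)⁻¹ else 0) - hardyRoot N k * (‖x‖ ^ 2)⁻¹ * x i ^ 2 :=
    fun i => by simp only [groundField]; ring
  rw [inner_eq_sum_coord]
  simp only [h1]
  rw [Finset.sum_sub_distrib, sum_coord_mul_inv hk hx, ← Finset.mul_sum, ← norm_sq_eq_sum_coord,
    mul_assoc, inv_mul_cancel₀ hr, hardyRoot]
  ring

/-- The terms are grouped by the integration by parts that evaluates them: each summand of the last
sum integrates to zero by `integral_inv_coord`, and the radial cross term is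
`integral_inner_inv_norm_sq`. -/
lemma norm_sq_flow (hk : k ≤ N) (v : EuclideanSpace ℝ (Fin N) → ℝ) {x : EuclideanSpace ℝ (Fin N)}
    (hx : x ∈ orthant N k) (h0 : x ≠ 0) :
    ‖flow N k v x‖ ^ 2 = ‖∇ v x‖ ^ 2 + hardyRoot N k * (2 * v x * inner ℝ (∇ v x) x * (‖x‖ ^ 2)⁻¹)
      + (hardyRoot N k - 2 * k) * (hardyRoot N k * (v x ^ 2 * (‖x‖ ^ 2)⁻¹))
      - ∑ i : Fin N, if N - k ≤ (i : ℕ) then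
          2 * v x * ∇ v x i * (x i)⁻¹ - v x ^ 2 * ((x i)⁻¹) ^ 2 else 0 := by
  have hr : ‖x‖ ^ 2 ≠ 0 := by simpa using h0
  have h1 : ∀ i : Fin N, (flow N k v x i) ^ 2 = (∇ v x i) ^ 2
      + hardyRoot N k * (2 * v x * (∇ v x i * x i) * (‖x‖ ^ 2)⁻¹)
      - 2 * hardyRoot N k * (v x ^ 2 * (‖x‖ ^ 2)⁻¹) *
          (x i * (if N - k ≤ (i : ℕ) then (x i)⁻¹ else 0))
      + hardyRoot N k ^ 2 * v x ^ 2 * ((‖x‖ ^ 2)⁻¹) ^ 2 * x i ^ 2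
      - (if N - k ≤ (i : ℕ) then
          2 * v x * ∇ v x i * (x i)⁻¹ - v x ^ 2 * ((x i)⁻¹) ^ 2 else 0) := fun i => by
    simp only [flow, groundField, PiLp.sub_apply, PiLp.smul_apply, smul_eq_mul]
    split_ifs <;> ring
  rw [norm_sq_eq_sum_coord]
  simp only [h1]
  rw [Finset.sum_sub_distrib, Finset.sum_add_distrib, Finset.sum_sub_distrib,
    Finset.sum_add_distrib, ← Finset.mul_sum, ← Finset.mul_sum, ← Finset.mul_sum,
    ← Finset.sum_mul, ← Finset.mul_sum, ← norm_sq_eq_sum_coord, ← norm_sq_eq_sum_coord,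
    ← inner_eq_sum_coord, sum_coord_mul_inv hk hx]
  field_simp
  ring

/-- The ground state representation of the critical Hardy form. -/
lemma integral_norm_sq_flow (hN : 2 ≤ N) (hk : k ≤ N) (v : 𝓓(orthant N k, ℝ)) :
    Integrable (fun x => ‖flow N k v x‖ ^ 2) (orthantVolume N k) ∧
    ∫ x, ‖∇ v x‖ ^ 2 ∂orthantVolume N k = ∫ x, ‖flow N k v x‖ ^ 2 ∂orthantVolume N k +
      hardyRoot N k * ∫ x, hardyRoot N k * (v x ^ 2 * (‖x‖ ^ 2)⁻¹) ∂orthantVolume N k := by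
  have hb : ∀ i : Fin N, Integrable (fun x => if N - k ≤ (i : ℕ) then
      2 * v x * ∇ v x i * (x i)⁻¹ - v x ^ 2 * ((x i)⁻¹) ^ 2 else 0) (orthantVolume N k) ∧
      ∫ x, (if N - k ≤ (i : ℕ) then
      2 * v x * ∇ v x i * (x i)⁻¹ - v x ^ 2 * ((x i)⁻¹) ^ 2 else 0) ∂(orthantVolume N k) = 0 := by
    intro i
    split_ifs with h
    · obtain ⟨a, b, c⟩ := integral_inv_coord v h
      exact ⟨a.sub b, by rw [integral_sub a b, c, sub_self]⟩
    · simp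
  have h1 := integrable_gradient_sq v
  obtain ⟨h2, h2'⟩ := integral_inner_inv_norm_sq hN hk v
  have h3 := (integrable_hardyRoot_mul hN hk v).const_mul (hardyRoot N k - 2 * k)
  have h4 := integrable_finsetSum Finset.univ fun i _ => (hb i).1
  have h12 := h1.fun_add h2
  have h123 := h12.fun_add h3
  have hae := (ae_mem_orthant_and_ne_zero (k := k) hN).mono fun x hx =>
    norm_sq_flow hk v hx.1 hx.2
  refine ⟨(h123.sub h4).congr (hae.mono fun x hx => hx.symm), ?_⟩
  rw [integral_congr_ae hae, integral_sub h123 h4, integral_add h12 h3,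
    integral_add h1 h2, h2', integral_const_mul (hardyRoot N k - 2 * k),
    integral_finsetSum _ fun i _ => (hb i).1,
    Finset.sum_eq_zero fun i _ => (hb i).2]
  -- With this the terms in `N - 2` cancel, and `v²/‖x‖²` keeps the coefficient `-hardyRoot²`.
  have h5 : hardyRoot N k - 2 * k = N - 2 - hardyRoot N k := by rw [hardyRoot]; ring
  rw [h5]
  ring

/-- A two-dimensional radial Hardy type inequality for `flow`. -/
lemma integral_radial_le_flow (hN : 2 ≤ N) (hk : k ≤ N) (v : 𝓓(orthant N k, ℝ)) {h : ℝ → ℝ}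
    (hh : ∀ s, 0 ≤ s → ContDiffAt ℝ 1 h s) :
    Integrable (fun x => v x ^ 2 * (2 * h (‖x‖ ^ 2) + 2 * ‖x‖ ^ 2 * deriv h (‖x‖ ^ 2)
      - ‖x‖ ^ 2 * h (‖x‖ ^ 2) ^ 2)) (orthantVolume N k) ∧
    ∫ x, v x ^ 2 * (2 * h (‖x‖ ^ 2) + 2 * ‖x‖ ^ 2 * deriv h (‖x‖ ^ 2)
      - ‖x‖ ^ 2 * h (‖x‖ ^ 2) ^ 2) ∂orthantVolume N k
      ≤ ∫ x, ‖flow N k v x‖ ^ 2 ∂orthantVolume N k := by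
  obtain ⟨a, b, c⟩ := integral_radial v hh
  have hc : Continuous (fun x : EuclideanSpace ℝ (Fin N) => h (‖x‖ ^ 2)) :=
    continuous_iff_continuousAt.2 fun x =>
      ContinuousAt.comp (f := fun x : EuclideanSpace ℝ (Fin N) => ‖x‖ ^ 2)
        (hh _ (sq_nonneg _)).continuousAt (by fun_prop)
  have d := integrable_sq_mul v (k := k)
    (g := fun x => (N - 2) * h (‖x‖ ^ 2) + ‖x‖ ^ 2 * h (‖x‖ ^ 2) ^ 2)
    ((hc.const_mul _).add ((continuous_norm.pow 2).mul (hc.pow 2))).continuousOn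
  obtain ⟨e, -⟩ := integral_norm_sq_flow hN hk v
  have hpt : ∀ᵐ x ∂orthantVolume N k, 0 ≤ ‖flow N k v x‖ ^ 2
      + 2 * v x * inner ℝ (∇ v x) x * h (‖x‖ ^ 2)
      + v x ^ 2 * ((N - 2) * h (‖x‖ ^ 2) + ‖x‖ ^ 2 * h (‖x‖ ^ 2) ^ 2) := by
    filter_upwards [ae_mem_orthant_and_ne_zero (k := k) hN] with x hx
    -- The `(N-2)/2` from `inner_groundField` enters here. It lowers the factor `N` of the
    -- divergence to `N - (N-2) = 2`.
    have h1 : ‖flow N k v x + (v x * h (‖x‖ ^ 2)) • x‖ ^ 2 = ‖flow N k v x‖ ^ 2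
      + 2 * v x * inner ℝ (∇ v x) x * h (‖x‖ ^ 2)
      + v x ^ 2 * ((N - 2) * h (‖x‖ ^ 2) + ‖x‖ ^ 2 * h (‖x‖ ^ 2) ^ 2) := by
      rw [norm_add_sq_real, inner_smul_right, norm_smul, mul_pow, Real.norm_eq_abs, sq_abs]
      have : inner ℝ (flow N k v x) x = inner ℝ (∇ v x) x + v x * ((N - 2) / 2) := by
        rw [flow, inner_sub_left, inner_smul_left, inner_groundField hk hx.1 hx.2]
        simp
      rw [this]; ring
    rw [← h1]; positivity
  have h0 := integral_nonneg_of_ae hpt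
  have ea := e.fun_add a
  rw [integral_add ea d, integral_add e a, c] at h0
  have hbd : ∀ x, v x ^ 2 * (2 * h (‖x‖ ^ 2) + 2 * ‖x‖ ^ 2 * deriv h (‖x‖ ^ 2)
      - ‖x‖ ^ 2 * h (‖x‖ ^ 2) ^ 2) = v x ^ 2 * (N * h (‖x‖ ^ 2) + 2 * ‖x‖ ^ 2 * deriv h (‖x‖ ^ 2))
      - v x ^ 2 * ((N - 2) * h (‖x‖ ^ 2) + ‖x‖ ^ 2 * h (‖x‖ ^ 2) ^ 2) := fun x => by ring
  simp only [hbd]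
  refine ⟨b.sub d, ?_⟩
  rw [integral_sub b d]
  linarith

end HardyForm

/-! ### Energy estimates and damping near the origin. -/

namespace HardyForm

variable {N k : ℕ} {lam : ℝ}

lemma integrable_norm_sq_mul (v : 𝓓(orthant N k, ℝ)) :
    Integrable (fun x => ‖x‖ ^ 2 / 16 * v x ^ 2) (orthantVolume N k) := by
  refine (integrable_sq_mul v (g := fun x => ‖x‖ ^ 2 / 16) (by fun_prop)).congr
    (.of_forall fun x => ?_)
  simp only [mul_comm]

lemma integrable_test_sq (v : 𝓓(orthant N k, ℝ)) :
    Integrable (fun x => v x ^ 2) (orthantVolume N k) := by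
  simpa using integrable_sq_mul v (g := fun _ => (1 : ℝ)) continuousOn_const

/-- The two parts are integrable separately, which covers `N = 2`, `k = 0`: there the first is zero
and the second is the condition defining `formCore`. -/
lemma integrable_hardy_gap (hN : 2 ≤ N) (hk : k ≤ N) {v : 𝓓(orthant N k, ℝ)}
    (hv : v ∈ formCore N k lam) :
    Integrable (fun x => (hardyConst N k - lam) * (v x ^ 2 * (‖x‖ ^ 2)⁻¹)) (orthantVolume N k) := by
  have hv' : Integrable (fun x => lam / ‖x‖ ^ 2 * |v x| ^ 2) (orthantVolume N k) := hv
  refine (((integrable_hardyRoot_mul hN hk v).const_mul (hardyRoot N k)).sub hv').congr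
    (.of_forall fun x => ?_)
  simp only [Pi.sub_apply, ← hardyRoot_sq, sq_abs]
  ring

/-- The ground state representation of the energy. -/
lemma energy_eq (hN : 2 ≤ N) (hk : k ≤ N) {v : 𝓓(orthant N k, ℝ)}
    (hv : v ∈ formCore N k lam) :
    energy N k lam v = ∫ x, ‖flow N k v x‖ ^ 2 ∂orthantVolume N k +
      ∫ x, (hardyConst N k - lam) * (v x ^ 2 * (‖x‖ ^ 2)⁻¹) ∂orthantVolume N k +
      ∫ x, ‖x‖ ^ 2 / 16 * v x ^ 2 ∂orthantVolume N k := by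
  have hv' : Integrable (fun x => lam / ‖x‖ ^ 2 * |v x| ^ 2) (orthantVolume N k) := hv
  obtain ⟨-, b⟩ := integral_norm_sq_flow hN hk v
  have h1 := (integrable_hardyRoot_mul hN hk v).const_mul (hardyRoot N k)
  have h2 : ∫ x, (hardyConst N k - lam) * (v x ^ 2 * (‖x‖ ^ 2)⁻¹) ∂orthantVolume N k =
      hardyRoot N k * ∫ x, hardyRoot N k * (v x ^ 2 * (‖x‖ ^ 2)⁻¹) ∂orthantVolume N k
      - ∫ x, lam / ‖x‖ ^ 2 * |v x| ^ 2 ∂orthantVolume N k := by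
    rw [← integral_const_mul, ← integral_sub h1 hv']
    refine integral_congr_ae (.of_forall fun x => ?_)
    simp only [← hardyRoot_sq, sq_abs]
    ring
  have h3 := integrable_norm_sq_mul v
  have h4 : Integrable (fun x => ‖∇ v x‖ ^ 2 - lam / ‖x‖ ^ 2 * |v x| ^ 2) (orthantVolume N k) :=
    (integrable_gradient_sq v).sub hv'
  simp only [← sq_abs (v _)] at h3
  rw [energy, integral_add h4 h3, integral_sub (integrable_gradient_sq v) hv', b, h2]
  simp only [sq_abs]
  ring

lemma hardy_gap_nonneg (hlam : lam ≤ hardyConst N k) (v : EuclideanSpace ℝ (Fin N) → ℝ)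
    (x : EuclideanSpace ℝ (Fin N)) : 0 ≤ (hardyConst N k - lam) * (v x ^ 2 * (‖x‖ ^ 2)⁻¹) :=
  mul_nonneg (sub_nonneg.2 hlam) (by positivity)

lemma energyNonneg (hN : 2 ≤ N) (hk : k ≤ N) (hlam : lam ≤ hardyConst N k) :
    EnergyNonneg N k lam := fun v => by
  rw [energy_eq hN hk v.2]
  have h1 : 0 ≤ ∫ x, ‖flow N k v.1 x‖ ^ 2 ∂orthantVolume N k :=
    integral_nonneg fun x => by positivity
  have h2 : 0 ≤ ∫ x, (hardyConst N k - lam) * (v.1 x ^ 2 * (‖x‖ ^ 2)⁻¹) ∂orthantVolume N k :=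
    integral_nonneg fun x => hardy_gap_nonneg hlam v.1 x
  have h3 : 0 ≤ ∫ x, ‖x‖ ^ 2 / 16 * v.1 x ^ 2 ∂orthantVolume N k :=
    integral_nonneg fun x => by positivity
  linarith

/-- Dropping the gap term makes the estimates below independent of how close `lam` is to the
critical value. -/
lemma integral_flow_add_le_energy (hN : 2 ≤ N) (hk : k ≤ N) (hlam : lam ≤ hardyConst N k)
    {v : 𝓓(orthant N k, ℝ)} (hv : v ∈ formCore N k lam) :
    ∫ x, ‖flow N k v x‖ ^ 2 ∂orthantVolume N k + ∫ x, ‖x‖ ^ 2 / 16 * v x ^ 2 ∂orthantVolume N k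
      ≤ energy N k lam v := by
  rw [energy_eq hN hk hv]
  have h2 : 0 ≤ ∫ x, (hardyConst N k - lam) * (v x ^ 2 * (‖x‖ ^ 2)⁻¹) ∂orthantVolume N k :=
    integral_nonneg fun x => hardy_gap_nonneg hlam v x
  linarith

/-- The spectral bound `energy v ≥ ‖v‖² / 2`. -/
lemma integral_sq_le_energy (hN : 2 ≤ N) (hk : k ≤ N) (hlam : lam ≤ hardyConst N k)
    {v : 𝓓(orthant N k, ℝ)} (hv : v ∈ formCore N k lam) :
    ∫ x, v x ^ 2 ∂orthantVolume N k ≤ 2 * energy N k lam v := by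
  obtain ⟨-, b⟩ := integral_radial_le_flow hN hk v (h := fun _ => 1 / 4)
    fun s _ => contDiffAt_const
  have h1 := integral_flow_add_le_energy hN hk hlam hv
  have h2 : ∀ x, v x ^ 2 * (2 * (1 / 4 : ℝ) + 2 * ‖x‖ ^ 2 * deriv (fun _ : ℝ => (1 / 4 : ℝ)) (‖x‖ ^ 2)
      - ‖x‖ ^ 2 * (1 / 4 : ℝ) ^ 2) = 1 / 2 * v x ^ 2 - ‖x‖ ^ 2 / 16 * v x ^ 2 := fun x => by
    rw [deriv_const]; ring
  simp only [h2] at b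
  rw [integral_sub ((integrable_test_sq v).const_mul _) (integrable_norm_sq_mul v),
    integral_const_mul] at b
  linarith

lemma integrable_sq_mul_inv_sqrt (v : 𝓓(orthant N k, ℝ)) {e : ℝ} (he : 0 < e) :
    Integrable (fun x => v x ^ 2 * (√(‖x‖ ^ 2 + e))⁻¹) (orthantVolume N k) := by
  refine integrable_sq_mul v (Continuous.continuousOn ?_)
  refine Continuous.inv₀ (by fun_prop) fun x => ?_
  positivity

/-- Uniform control of the energy on the mass near the origin. -/
lemma integral_sq_mul_inv_sqrt_le_energy (hN : 2 ≤ N) (hk : k ≤ N) (hlam : lam ≤ hardyConst N k)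
    {v : 𝓓(orthant N k, ℝ)} (hv : v ∈ formCore N k lam) {e : ℝ} (he : 0 < e) :
    ∫ x, v x ^ 2 * (√(‖x‖ ^ 2 + e))⁻¹ ∂orthantVolume N k ≤ 3 * energy N k lam v := by
  have hd : ∀ s, 0 ≤ s → HasDerivAt (fun s => (√(s + e))⁻¹)
      (-(1 / 2 * ((√(s + e))⁻¹) ^ 3)) s := fun s hs => by
    have hp : 0 < s + e := by positivity
    have hq : 0 < √(s + e) := Real.sqrt_pos.2 hp
    refine ((((hasDerivAt_id s).add_const e).sqrt hp.ne').inv hq.ne').congr_deriv ?_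
    simp only [id]
    field_simp
  obtain ⟨a, b⟩ := integral_radial_le_flow hN hk v (h := fun s => (√(s + e))⁻¹)
    fun s hs => by
      have hp : s + e ≠ 0 := by positivity
      have hq : √(s + e) ≠ 0 := by positivity
      exact ((contDiffAt_id.add contDiffAt_const).sqrt hp).inv hq
  have hder : ∀ x : EuclideanSpace ℝ (Fin N), deriv (fun s => (√(s + e))⁻¹) (‖x‖ ^ 2) =
    -(1 / 2 * ((√(‖x‖ ^ 2 + e))⁻¹) ^ 3) := fun x => (hd _ (sq_nonneg _)).deriv
  simp only [hder] at a b
  have h1 := integral_flow_add_le_energy hN hk hlam hv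
  have h2 := integral_sq_le_energy hN hk hlam hv
  have h3 : 0 ≤ ∫ x, ‖x‖ ^ 2 / 16 * v x ^ 2 ∂orthantVolume N k :=
    integral_nonneg fun x => by positivity
  have h5 : Integrable (fun x => v x ^ 2 * (√(‖x‖ ^ 2 + e))⁻¹ - v x ^ 2) (orthantVolume N k) :=
    (integrable_sq_mul_inv_sqrt v he).sub (integrable_test_sq v)
  -- For `h = (s+e)^(-1/2)` one has `h' = -h³/2` and `s h² ≤ 1`, so `2h + 2sh' - sh² ≥ h - 1`.
  have h4 := integral_mono h5 a fun x => by
      have hp : 0 < ‖x‖ ^ 2 + e := by positivity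
      have hq : 0 < √(‖x‖ ^ 2 + e) := Real.sqrt_pos.2 hp
      have hs : ‖x‖ ^ 2 ≤ √(‖x‖ ^ 2 + e) ^ 2 := by rw [Real.sq_sqrt hp.le]; linarith
      have h5 : ‖x‖ ^ 2 * ((√(‖x‖ ^ 2 + e))⁻¹) ^ 2 ≤ 1 := by
        rw [inv_pow, ← div_eq_mul_inv]; exact div_le_one_of_le₀ hs (by positivity)
      have h6 : 0 < (√(‖x‖ ^ 2 + e))⁻¹ := by positivity
      have h7 : ‖x‖ ^ 2 * ((√(‖x‖ ^ 2 + e))⁻¹) ^ 3 ≤ (√(‖x‖ ^ 2 + e))⁻¹ := by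
        calc _ = ‖x‖ ^ 2 * ((√(‖x‖ ^ 2 + e))⁻¹) ^ 2 * (√(‖x‖ ^ 2 + e))⁻¹ := by ring
          _ ≤ 1 * (√(‖x‖ ^ 2 + e))⁻¹ := by gcongr
          _ = _ := one_mul _
      have h8 : (√(‖x‖ ^ 2 + e))⁻¹ - 1 ≤ 2 * (√(‖x‖ ^ 2 + e))⁻¹
        + 2 * ‖x‖ ^ 2 * -(1 / 2 * ((√(‖x‖ ^ 2 + e))⁻¹) ^ 3)
        - ‖x‖ ^ 2 * ((√(‖x‖ ^ 2 + e))⁻¹) ^ 2 := by linarith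
      calc _ = v x ^ 2 * ((√(‖x‖ ^ 2 + e))⁻¹ - 1) := by ring
        _ ≤ _ := by gcongr
  rw [integral_sub (integrable_sq_mul_inv_sqrt v he) (integrable_test_sq v)] at h4
  linarith

/-- The smooth function `‖x‖² / (‖x‖² + e)`, which damps a neighbourhood of the origin. -/
noncomputable def damping (N : ℕ) (e : ℝ) (x : EuclideanSpace ℝ (Fin N)) : ℝ :=
  ‖x‖ ^ 2 * (‖x‖ ^ 2 + e)⁻¹

lemma contDiff_damping {e : ℝ} (he : 0 < e) {n : WithTop ℕ∞} : ContDiff ℝ n (damping N e) :=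
  (contDiff_norm_sq ℝ).mul (((contDiff_norm_sq ℝ).add contDiff_const).inv fun x => by positivity)

lemma gradient_damping {e : ℝ} (he : 0 < e) (x : EuclideanSpace ℝ (Fin N)) :
    ∇ (damping N e) x = (2 * e * ((‖x‖ ^ 2 + e)⁻¹) ^ 2) • x := by
  have h1 := (hasStrictFDerivAt_norm_sq x).hasFDerivAt
  have hp : ‖x‖ ^ 2 + e ≠ 0 := by positivity
  have h2 := h1.mul ((hasDerivAt_inv hp).comp_hasFDerivAt x (h1.add_const e))
  ext i
  refine (gradient_coord_of_hasFDerivAt h2 i).trans ?_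
  simp [EuclideanSpace.inner_single_right]
  field_simp
  ring

/-- The product of a test function with `damping`. -/
noncomputable def dampedTest {e : ℝ} (he : 0 < e) (v : 𝓓(orthant N k, ℝ)) : 𝓓(orthant N k, ℝ) where
  toFun x := damping N e x * v x
  contDiff' := (contDiff_damping he).mul v.contDiff
  hasCompactSupport' := v.hasCompactSupport.mul_left
  tsupport_subset' := (tsupport_mul_subset_right).trans v.tsupport_subset

lemma dampedTest_apply {e : ℝ} (he : 0 < e) (v : 𝓓(orthant N k, ℝ))
    (x : EuclideanSpace ℝ (Fin N)) : dampedTest he v x = damping N e x * v x := rfl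

/-- The Leibniz rule: the zeroth-order part of `flow` commutes with multiplication by `damping`. -/
lemma flow_dampedTest {e : ℝ} (he : 0 < e) (v : 𝓓(orthant N k, ℝ))
    (x : EuclideanSpace ℝ (Fin N)) : flow N k (dampedTest he v) x =
      damping N e x • flow N k v x + v x • ∇ (damping N e) x := by
  have h1 : ∇ (dampedTest he v) x = damping N e x • ∇ v x + v x • ∇ (damping N e) x := by
    have h2 := (((contDiff_damping (n := 1) he).differentiable (by simp) x).hasFDerivAt.mul
      (differentiable_test v x).hasFDerivAt)
    ext i
    refine (gradient_coord_of_hasFDerivAt h2 i).trans ?_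
    simp [gradient_coord]
  rw [flow, h1, flow, dampedTest_apply, smul_sub, mul_smul]
  abel

/-- This is `s e ≤ (s+e)²` with `s = ‖x‖²`. -/
lemma norm_sq_mul_inv_sq_le {e : ℝ} (he : 0 < e) (x : EuclideanSpace ℝ (Fin N)) :
    ‖x‖ ^ 2 * ((‖x‖ ^ 2 + e)⁻¹) ^ 2 ≤ e⁻¹ := by
  have hp : 0 < ‖x‖ ^ 2 + e := by positivity
  rw [inv_pow, ← div_eq_mul_inv, div_le_iff₀ (by positivity), inv_mul_eq_div, le_div_iff₀ he]
  nlinarith [sq_nonneg ‖x‖, sq_nonneg (‖x‖ ^ 2)]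

lemma damping_nonneg {e : ℝ} (he : 0 < e) (x : EuclideanSpace ℝ (Fin N)) : 0 ≤ damping N e x := by
  unfold damping; positivity

lemma damping_le_one {e : ℝ} (he : 0 < e) (x : EuclideanSpace ℝ (Fin N)) : damping N e x ≤ 1 := by
  rw [damping, ← div_eq_mul_inv]
  exact div_le_one_of_le₀ (by linarith) (by positivity)

/-- The damped function has a finite Dirichlet integral, controlled by the energy. -/
lemma integral_gradient_dampedTest_le (hN : 2 ≤ N) (hk : k ≤ N) (hlam : lam ≤ hardyConst N k)
    {v : 𝓓(orthant N k, ℝ)} (hv : v ∈ formCore N k lam) {e : ℝ} (he : 0 < e) :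
    ∫ x, ‖∇ (dampedTest he v) x‖ ^ 2 ∂orthantVolume N k ≤
      (2 + (16 + 2 * hardyConst N k) * e⁻¹) * energy N k lam v := by
  obtain ⟨a, b⟩ := integral_norm_sq_flow hN hk (dampedTest he v)
  obtain ⟨c, -⟩ := integral_norm_sq_flow hN hk v
  have h1 := integral_flow_add_le_energy hN hk hlam hv
  have h2 := integral_sq_le_energy hN hk hlam hv
  have h3 : 0 ≤ ∫ x, ‖x‖ ^ 2 / 16 * v x ^ 2 ∂orthantVolume N k :=
    integral_nonneg fun x => by positivity
  have hi := (c.const_mul 2).fun_add ((integrable_test_sq v).const_mul (8 * e⁻¹))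
  have h4 := integral_mono a hi fun x => by
    have hn := damping_nonneg he x
    have hl := damping_le_one he x
    have hA : ‖damping N e x • flow N k v x‖ ^ 2 ≤ ‖flow N k v x‖ ^ 2 := by
      rw [norm_smul, mul_pow, Real.norm_of_nonneg hn]
      exact mul_le_of_le_one_left (sq_nonneg _) (pow_le_one₀ hn hl)
    have hB : ‖v x • ∇ (damping N e) x‖ ^ 2 ≤ 4 * e⁻¹ * v x ^ 2 := by
      rw [norm_smul, mul_pow, Real.norm_eq_abs, sq_abs, gradient_damping he, norm_smul, mul_pow,
        Real.norm_eq_abs, sq_abs]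
      have hp : 0 < ‖x‖ ^ 2 + e := by positivity
      have h5 := norm_sq_mul_inv_sq_le he x
      have h6 : (e * (‖x‖ ^ 2 + e)⁻¹) ^ 2 ≤ 1 := by
        refine pow_le_one₀ (by positivity) ?_
        rw [← div_eq_mul_inv]
        exact div_le_one_of_le₀ (by linarith [sq_nonneg ‖x‖]) hp.le
      calc v x ^ 2 * ((2 * e * ((‖x‖ ^ 2 + e)⁻¹) ^ 2) ^ 2 * ‖x‖ ^ 2)
          = v x ^ 2 * (4 * ((e * (‖x‖ ^ 2 + e)⁻¹) ^ 2 * (‖x‖ ^ 2 * ((‖x‖ ^ 2 + e)⁻¹) ^ 2))) := by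
            ring
        _ ≤ v x ^ 2 * (4 * (1 * e⁻¹)) := by gcongr
        _ = _ := by ring
    have hC := norm_add_le (damping N e x • flow N k v x) (v x • ∇ (damping N e) x)
    rw [flow_dampedTest]
    have hD := norm_nonneg (damping N e x • flow N k v x + v x • ∇ (damping N e) x)
    nlinarith [sq_nonneg (‖damping N e x • flow N k v x‖ - ‖v x • ∇ (damping N e) x‖)]
  rw [integral_add (c.const_mul 2) ((integrable_test_sq v).const_mul (8 * e⁻¹)),
    integral_const_mul, integral_const_mul] at h4
  -- The damping cancels the Hardy singularity: `damping²/‖x‖² ≤ 1/e`.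
  have h5 : hardyRoot N k * ∫ x, hardyRoot N k * (dampedTest he v x ^ 2 * (‖x‖ ^ 2)⁻¹)
      ∂orthantVolume N k ≤ hardyConst N k * e⁻¹ * ∫ x, v x ^ 2 ∂orthantVolume N k := by
    rw [← integral_const_mul, ← integral_const_mul]
    refine integral_mono ((integrable_hardyRoot_mul hN hk _).const_mul _)
      ((integrable_test_sq v).const_mul _) fun x => ?_
    have h5 := norm_sq_mul_inv_sq_le he x
    calc hardyRoot N k * (hardyRoot N k * (dampedTest he v x ^ 2 * (‖x‖ ^ 2)⁻¹))
        = hardyRoot N k ^ 2 * (‖x‖ ^ 2 * (‖x‖ ^ 2)⁻¹ * (‖x‖ ^ 2 * ((‖x‖ ^ 2 + e)⁻¹) ^ 2)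
          * v x ^ 2) := by
          rw [dampedTest_apply, damping]; ring
      _ ≤ hardyRoot N k ^ 2 * (1 * e⁻¹ * v x ^ 2) := by
          gcongr
          -- An inequality, not an equality: at the origin the product is `0`.
          exact mul_inv_le_one
      _ = _ := by rw [← hardyRoot_sq]; ring
  have h6 : 0 ≤ hardyConst N k * e⁻¹ := mul_nonneg (sq_nonneg _) (by positivity)
  have h7 : 0 ≤ e⁻¹ := by positivity
  have h8 := mul_le_mul_of_nonneg_left h2 h6
  have h9 := mul_le_mul_of_nonneg_left h2 h7
  linarith

/-- Damping changes a function little in `L²`, uniformly on bounded energy. -/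
lemma integral_sub_dampedTest_sq_le (hN : 2 ≤ N) (hk : k ≤ N) (hlam : lam ≤ hardyConst N k)
    {v : 𝓓(orthant N k, ℝ)} (hv : v ∈ formCore N k lam) {e : ℝ} (he : 0 < e) :
    ∫ x, (v - dampedTest he v) x ^ 2 ∂orthantVolume N k ≤ 3 * √e * energy N k lam v := by
  have h1 := integral_sq_mul_inv_sqrt_le_energy hN hk hlam hv he
  have h2 : ∫ x, (v - dampedTest he v) x ^ 2 ∂orthantVolume N k ≤
      √e * ∫ x, v x ^ 2 * (√(‖x‖ ^ 2 + e))⁻¹ ∂orthantVolume N k := by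
    rw [← integral_const_mul]
    refine integral_mono (integrable_test_sq _) ((integrable_sq_mul_inv_sqrt v he).const_mul _)
      fun x => ?_
    have hp : 0 < ‖x‖ ^ 2 + e := by positivity
    have hq : 0 < √(‖x‖ ^ 2 + e) := Real.sqrt_pos.2 hp
    have h3 : √e * (√(‖x‖ ^ 2 + e))⁻¹ ≤ 1 := by
      rw [← div_eq_mul_inv]
      exact div_le_one_of_le₀ (Real.sqrt_le_sqrt (by linarith [sq_nonneg ‖x‖])) hq.le
    have h4 : e * (‖x‖ ^ 2 + e)⁻¹ = (√e * (√(‖x‖ ^ 2 + e))⁻¹) ^ 2 := by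
      rw [mul_pow, inv_pow, Real.sq_sqrt he.le, Real.sq_sqrt hp.le]
    have h5 : (v - dampedTest he v) x = e * (‖x‖ ^ 2 + e)⁻¹ * v x := by
      change v x - damping N e x * v x = _
      rw [damping]; field_simp; ring
    have h6 : 0 ≤ √e * (√(‖x‖ ^ 2 + e))⁻¹ := by positivity
    rw [h5, mul_pow, h4]
    -- With `q = √e/√(‖x‖²+e) ≤ 1` the difference is `q² v`, and `q⁴ ≤ q`.
    calc ((√e * (√(‖x‖ ^ 2 + e))⁻¹) ^ 2) ^ 2 * v x ^ 2
        = (√e * (√(‖x‖ ^ 2 + e))⁻¹) ^ 3 * (√e * (√(‖x‖ ^ 2 + e))⁻¹) * v x ^ 2 := by ring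
      _ ≤ 1 * (√e * (√(‖x‖ ^ 2 + e))⁻¹) * v x ^ 2 := by
          gcongr; exact pow_le_one₀ h6 h3
      _ = _ := by ring
  have h3 := mul_le_mul_of_nonneg_left h1 (Real.sqrt_nonneg e)
  linarith

end HardyForm

/-! ### Translations and a Poincaré inequality on disjoint cells. -/

namespace HardyForm

lemma sq_integral_le_integral_sq {α : Type*} [MeasurableSpace α] {ν : Measure α}
    [IsProbabilityMeasure ν] {g : α → ℝ} (hg : Integrable g ν)
    (hg2 : Integrable (fun x => g x ^ 2) ν) : (∫ x, g x ∂ν) ^ 2 ≤ ∫ x, g x ^ 2 ∂ν := by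
  have h1 : Integrable (fun x => 2 * (∫ y, g y ∂ν) * g x) ν := hg.const_mul _
  have h2 : Integrable (fun x => g x ^ 2 - 2 * (∫ y, g y ∂ν) * g x) ν := hg2.sub h1
  have h3 : 0 ≤ ∫ x, (g x ^ 2 - 2 * (∫ y, g y ∂ν) * g x + (∫ y, g y ∂ν) ^ 2) ∂ν :=
    integral_nonneg fun x => by
      have := sq_nonneg (g x - ∫ y, g y ∂ν)
      simp only [Pi.zero_apply]
      linarith
  rw [integral_add h2 (integrable_const _), integral_sub hg2 h1, integral_const_mul] at h3
  simp at h3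
  nlinarith

/-- The fundamental theorem of calculus along the segment, then Jensen on the unit interval. -/
lemma sub_translate_sq_le {E : Type*} [NormedAddCommGroup E] [NormedSpace ℝ E] {u : E → ℝ} (hu : ContDiff ℝ 1 u) (x z : E) :
    (u (x + z) - u x) ^ 2 ≤
      ∫ t in Ioc (0 : ℝ) 1, (fderiv ℝ u (x + t • z) z) ^ 2 := by
  have hc : Continuous fun t : ℝ => fderiv ℝ u (x + t • z) z :=
    ((hu.continuous_fderiv (by simp)).comp (by fun_prop)).clm_apply continuous_const
  have hd : ∀ t : ℝ, HasDerivAt (fun t : ℝ => u (x + t • z)) (fderiv ℝ u (x + t • z) z) t :=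
    fun t => by
      have h1 : HasDerivAt (fun t : ℝ => x + t • z) z t := by
        simpa using ((hasDerivAt_id t).smul_const z).const_add x
      exact ((hu.differentiable (by simp) _).hasFDerivAt).comp_hasDerivAt t h1
  have h1 := intervalIntegral.integral_eq_sub_of_hasDerivAt (fun t _ => hd t)
    (hc.intervalIntegrable 0 1)
  simp only [one_smul, zero_smul, add_zero] at h1
  rw [← h1, intervalIntegral.integral_of_le zero_le_one]
  have : IsProbabilityMeasure (volume.restrict (Ioc (0 : ℝ) 1)) := ⟨by simp⟩
  exact sq_integral_le_integral_sq (hc.integrableOn_Ioc) ((hc.pow 2).integrableOn_Ioc)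

/-- The variance written with differences only, so that translation estimates apply to it. -/
lemma setIntegral_sq_eq {α : Type*} [MeasurableSpace α] {ν : Measure α} {u : α → ℝ} {Q : Set α}
    (hQ : ν Q ≠ ⊤) (hu : IntegrableOn u Q ν) (hu2 : IntegrableOn (fun x => u x ^ 2) Q ν) :
    ∫ x in Q, ∫ y in Q, (u y - u x) ^ 2 ∂ν ∂ν =
      2 * (ν.real Q * ∫ x in Q, u x ^ 2 ∂ν) - 2 * (∫ x in Q, u x ∂ν) ^ 2 := by
  have : IsFiniteMeasure (ν.restrict Q) := ⟨by simpa using hQ.lt_top⟩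
  have h1 : ∀ x, ∫ y in Q, (u y - u x) ^ 2 ∂ν =
      ∫ y in Q, u y ^ 2 ∂ν - 2 * (∫ y in Q, u y ∂ν) * u x + ν.real Q * u x ^ 2 := fun x => by
    have e1 : ∀ y, (u y - u x) ^ 2 = u y ^ 2 - 2 * u x * u y + u x ^ 2 := fun y => by ring
    have e2 : IntegrableOn (fun y => 2 * u x * u y) Q ν := hu.const_mul _
    have e3 : IntegrableOn (fun y => u y ^ 2 - 2 * u x * u y) Q ν := hu2.sub e2
    simp only [e1]
    rw [integral_add e3 (integrable_const _), integral_sub hu2 e2, integral_const_mul]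
    simp
    ring
  simp only [h1]
  have e2 : IntegrableOn (fun x => 2 * (∫ y in Q, u y ∂ν) * u x) Q ν := hu.const_mul _
  have e3 : IntegrableOn (fun x => ∫ y in Q, u y ^ 2 ∂ν - 2 * (∫ y in Q, u y ∂ν) * u x) Q ν :=
    (integrable_const _).sub e2
  rw [integral_add e3 (hu2.const_mul _), integral_sub (integrable_const _) e2, integral_const_mul,
    integral_const_mul]
  simp
  ring

section Translation

variable {E : Type*} [NormedAddCommGroup E] [NormedSpace ℝ E] [FiniteDimensional ℝ E]
  [MeasurableSpace E] [BorelSpace E] {μ : Measure E} [μ.IsAddHaarMeasure]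

lemma integrable_translate_mul {g : E → ℝ} (hg : Continuous g) (hc : HasCompactSupport g) (z : E) :
    Integrable (fun p : E × ℝ => g (p.1 + p.2 • z)) (μ.prod (volume.restrict (Ioc (0 : ℝ) 1))) := by
  have hm : AEStronglyMeasurable (fun p : E × ℝ => g (p.1 + p.2 • z))
      (μ.prod (volume.restrict (Ioc (0 : ℝ) 1))) :=
    (hg.comp (by fun_prop : Continuous fun p : E × ℝ => p.1 + p.2 • z)).aestronglyMeasurable
  have hi : Integrable g μ := hg.integrable_of_hasCompactSupport hc
  refine (integrable_prod_iff' hm).2 ⟨.of_forall fun t => hi.comp_add_right (t • z), ?_⟩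
  have : ∀ t : ℝ, ∫ x, ‖g (x + t • z)‖ ∂μ = ∫ x, ‖g x‖ ∂μ := fun t =>
    integral_add_right_eq_self (μ := μ) (fun x => ‖g x‖) (t • z)
  simp only [this]
  exact integrable_const _

/-- Translating a function by `z` changes it in `L²` by at most `‖z‖` times its Dirichlet norm. -/
lemma integral_sub_translate_sq_le {u : E → ℝ} (hu : ContDiff ℝ 1 u) (hc : HasCompactSupport u)
    (z : E) : ∫ x, (u (x + z) - u x) ^ 2 ∂μ ≤ ‖z‖ ^ 2 * ∫ x, ‖fderiv ℝ u x‖ ^ 2 ∂μ := by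
  have hcf : Continuous (fderiv ℝ u) := hu.continuous_fderiv (by simp)
  have hsf : HasCompactSupport (fderiv ℝ u) := hc.fderiv (𝕜 := ℝ)
  have hg : Continuous fun x => (fderiv ℝ u x z) ^ 2 := (hcf.clm_apply continuous_const).pow 2
  have hgs : HasCompactSupport fun x => (fderiv ℝ u x z) ^ 2 :=
    hsf.comp_left (g := fun L : E →L[ℝ] ℝ => (L z) ^ 2) (by simp)
  have hns : HasCompactSupport fun x => ‖fderiv ℝ u x‖ ^ 2 := hsf.norm.mono fun x hx => by
    simp only [Function.mem_support] at hx ⊢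
    intro h0; exact hx (by simp [h0])
  have hi := integrable_translate_mul (μ := μ) hg hgs z
  calc ∫ x, (u (x + z) - u x) ^ 2 ∂μ
      ≤ ∫ x, (∫ t in Ioc (0 : ℝ) 1, (fderiv ℝ u (x + t • z) z) ^ 2) ∂μ :=
        integral_mono_of_nonneg (.of_forall fun x => sq_nonneg _) hi.integral_prod_left
          (.of_forall fun x => sub_translate_sq_le hu x z)
    _ = ∫ t in Ioc (0 : ℝ) 1, ∫ x, (fderiv ℝ u (x + t • z) z) ^ 2 ∂μ := integral_integral_swap hi
    _ = ∫ x, (fderiv ℝ u x z) ^ 2 ∂μ := by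
        have : ∀ t : ℝ, ∫ x, (fderiv ℝ u (x + t • z) z) ^ 2 ∂μ = ∫ x, (fderiv ℝ u x z) ^ 2 ∂μ :=
          fun t => integral_add_right_eq_self (μ := μ) (fun x => (fderiv ℝ u x z) ^ 2) (t • z)
        simp only [this]
        rw [setIntegral_const]
        simp
    _ ≤ ∫ x, ‖z‖ ^ 2 * ‖fderiv ℝ u x‖ ^ 2 ∂μ := by
        refine integral_mono (hg.integrable_of_hasCompactSupport hgs)
          (Integrable.const_mul ((hcf.norm.pow 2).integrable_of_hasCompactSupport
            hns) _) fun x => ?_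
        have := (fderiv ℝ u x).le_opNorm z
        rw [← mul_pow, mul_comm ‖z‖, ← sq_abs, ← Real.norm_eq_abs]
        gcongr
    _ = _ := integral_const_mul _ _

/-- Justifies the exchange of integrals below: the integral over `x` is bounded uniformly for `z` in
`D`, and `D` has finite measure. -/
lemma integrable_sub_translate_sq {u : E → ℝ} (hu : ContDiff ℝ 1 u) (hc : HasCompactSupport u)
    {D : Set E} (hDm : MeasurableSet D) (hD : μ D ≠ ⊤) {ρ : ℝ} (hρ : ∀ z ∈ D, ‖z‖ ≤ ρ) :
    Integrable (fun p : E × E => (u (p.1 + p.2) - u p.1) ^ 2) (μ.prod (μ.restrict D)) := by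
  have hcont : Continuous fun p : E × E => (u (p.1 + p.2) - u p.1) ^ 2 := by
    have := hu.continuous
    fun_prop
  have hm : AEStronglyMeasurable (fun p : E × E => (u (p.1 + p.2) - u p.1) ^ 2)
      (μ.prod (μ.restrict D)) := hcont.aestronglyMeasurable
  refine (integrable_prod_iff' hm).2 ⟨.of_forall fun z => ?_, ?_⟩
  · have h1 : HasCompactSupport fun x => u (x + z) := hc.comp_homeomorph (Homeomorph.addRight z)
    exact (Continuous.integrable_of_hasCompactSupport
      (by fun_prop) ((h1.sub hc).comp_left (g := fun t : ℝ => t ^ 2) (by simp)))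
  · have : IsFiniteMeasure (μ.restrict D) := ⟨by simpa using hD.lt_top⟩
    refine (integrable_const (ρ ^ 2 * ∫ x, ‖fderiv ℝ u x‖ ^ 2 ∂μ)).mono'
      (hm.norm.prod_swap.integral_prod_right') ?_
    filter_upwards [ae_restrict_mem hDm] with z hz
    have h2 : ∀ x, ‖(u (x + z) - u x) ^ 2‖ = (u (x + z) - u x) ^ 2 := fun x =>
      Real.norm_of_nonneg (sq_nonneg _)
    simp only [h2]
    rw [Real.norm_of_nonneg (integral_nonneg fun x => sq_nonneg _)]
    refine (integral_sub_translate_sq_le hu hc z).trans ?_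
    have h3 : 0 ≤ ∫ x, ‖fderiv ℝ u x‖ ^ 2 ∂μ := integral_nonneg fun x => sq_nonneg _
    have := hρ z hz
    gcongr

lemma integral_integral_sub_translate_sq_le {u : E → ℝ} (hu : ContDiff ℝ 1 u)
    (hc : HasCompactSupport u) {D : Set E} (hDm : MeasurableSet D) (hD : μ D ≠ ⊤) {ρ : ℝ}
    (hρ : ∀ z ∈ D, ‖z‖ ≤ ρ) :
    ∫ x, ∫ z in D, (u (x + z) - u x) ^ 2 ∂μ ∂μ ≤
      μ.real D * (ρ ^ 2 * ∫ x, ‖fderiv ℝ u x‖ ^ 2 ∂μ) := by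
  have hi := integrable_sub_translate_sq (μ := μ) hu hc hDm hD hρ
  have : IsFiniteMeasure (μ.restrict D) := ⟨by simpa using hD.lt_top⟩
  rw [integral_integral_swap (f := fun x z => (u (x + z) - u x) ^ 2) hi]
  calc ∫ z in D, ∫ x, (u (x + z) - u x) ^ 2 ∂μ ∂μ
      ≤ ∫ z in D, ρ ^ 2 * ∫ x, ‖fderiv ℝ u x‖ ^ 2 ∂μ ∂μ := by
        refine integral_mono_of_nonneg (.of_forall fun z => integral_nonneg fun x => sq_nonneg _)
          (integrable_const _) ?_
        filter_upwards [ae_restrict_mem hDm] with z hz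
        refine (integral_sub_translate_sq_le hu hc z).trans ?_
        have h3 : 0 ≤ ∫ x, ‖fderiv ℝ u x‖ ^ 2 ∂μ := integral_nonneg fun x => sq_nonneg _
        have := hρ z hz
        gcongr
    _ = _ := by simp

/-- Substitute `y = x + z`; if `x` and `y` lie in `Q` then `z` lies in `D`. -/
lemma setIntegral_sub_sq_le_translate {u : E → ℝ} (hu : ContDiff ℝ 1 u) {D Q : Set E}
    (hDm : MeasurableSet D) (hDb : Bornology.IsBounded D) (hQm : MeasurableSet Q)
    (hQD : ∀ x ∈ Q, ∀ y ∈ Q, y - x ∈ D) {x : E} (hx : x ∈ Q) :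
    ∫ y in Q, (u y - u x) ^ 2 ∂μ ≤ ∫ z in D, (u (x + z) - u x) ^ 2 ∂μ := by
  have hcont := hu.continuous
  rw [← integral_indicator hQm, ← integral_indicator hDm,
    ← integral_add_left_eq_self (μ := μ) (Q.indicator fun y => (u y - u x) ^ 2) x]
  refine integral_mono_of_nonneg (.of_forall fun z => indicator_nonneg (fun _ _ => sq_nonneg _) _)
    ?_ (.of_forall fun z => ?_)
  · refine IntegrableOn.integrable_indicator ?_ hDm
    exact (Continuous.locallyIntegrable (by fun_prop) |>.integrableOn_isCompact
      hDb.isCompact_closure).mono_set subset_closure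
  · by_cases hz : x + z ∈ Q
    · have : z ∈ D := by simpa using hQD x hx _ hz
      simp [hz, this]
    · simp only [indicator_of_notMem hz]
      exact indicator_nonneg (fun _ _ => sq_nonneg _) _

/-- A Poincaré inequality on a finite family of disjoint cells of small diameter. -/
lemma sum_setIntegral_sq_le {ι : Type*} (S : Finset ι) {Q : ι → Set E} {u : E → ℝ}
    (hu : ContDiff ℝ 1 u) (hc : HasCompactSupport u) {D : Set E} (hDm : MeasurableSet D)
    (hQm : ∀ m, MeasurableSet (Q m)) (hdisj : Pairwise (Function.onFun Disjoint Q))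
    (hQD : ∀ m, ∀ x ∈ Q m, ∀ y ∈ Q m, y - x ∈ D) {ρ c : ℝ} (hρ : ∀ z ∈ D, ‖z‖ ≤ ρ) (hc0 : 0 < c)
    (hQ : ∀ m, μ.real (Q m) = c) :
    ∑ m ∈ S, ∫ x in Q m, u x ^ 2 ∂μ ≤
      c⁻¹ * ∑ m ∈ S, (∫ x in Q m, u x ∂μ) ^ 2 +
        μ.real D / (2 * c) * ρ ^ 2 * ∫ x, ‖fderiv ℝ u x‖ ^ 2 ∂μ := by
  have hDb : Bornology.IsBounded D := (isBounded_iff_forall_norm_le).2 ⟨ρ, hρ⟩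
  have hD : μ D ≠ ⊤ := hDb.measure_lt_top.ne
  have hQf : ∀ m, μ (Q m) ≠ ⊤ := fun m h => by
    have := hQ m
    rw [Measure.real, h] at this
    simp at this
    exact hc0.ne this
  have hui : Integrable u μ := hu.continuous.integrable_of_hasCompactSupport hc
  have hui2 : Integrable (fun x => u x ^ 2) μ := (hu.continuous.pow 2).integrable_of_hasCompactSupport
    (hc.mono fun x hx => by
      simp only [Function.mem_support] at hx ⊢
      intro h0; exact hx (by simp [h0]))
  have hi := integrable_sub_translate_sq (μ := μ) hu hc hDm hD hρ
  have hW : Integrable (fun x => ∫ z in D, (u (x + z) - u x) ^ 2 ∂μ) μ := hi.integral_prod_left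
  have h1 : ∀ m ∈ S, ∫ x in Q m, ∫ y in Q m, (u y - u x) ^ 2 ∂μ ∂μ ≤
      ∫ x in Q m, ∫ z in D, (u (x + z) - u x) ^ 2 ∂μ ∂μ := fun m _ => by
    refine integral_mono_of_nonneg (.of_forall fun x => integral_nonneg fun _ => sq_nonneg _)
      hW.integrableOn ?_
    filter_upwards [ae_restrict_mem (hQm m)] with x hx
    exact setIntegral_sub_sq_le_translate hu hDm hDb (hQm m) (hQD m) hx
  -- The integrand no longer depends on the cell, so disjoint cells add up to at most the whole
  -- space.
  have h2 : ∑ m ∈ S, ∫ x in Q m, ∫ z in D, (u (x + z) - u x) ^ 2 ∂μ ∂μ ≤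
      ∫ x, ∫ z in D, (u (x + z) - u x) ^ 2 ∂μ ∂μ := by
    rw [← integral_biUnion_finset S (fun m _ => hQm m) (fun i _ j _ hij => hdisj hij)
      (fun m _ => hW.integrableOn)]
    exact setIntegral_le_integral hW (.of_forall fun x => integral_nonneg fun _ => sq_nonneg _)
  have h3 := (Finset.sum_le_sum h1).trans
    (h2.trans (integral_integral_sub_translate_sq_le hu hc hDm hD hρ))
  have h4 : ∀ m, ∫ x in Q m, ∫ y in Q m, (u y - u x) ^ 2 ∂μ ∂μ =
      2 * (c * ∫ x in Q m, u x ^ 2 ∂μ) - 2 * (∫ x in Q m, u x ∂μ) ^ 2 := fun m => by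
    rw [setIntegral_sq_eq (hQf m) hui.integrableOn hui2.integrableOn, hQ m]
  simp only [h4] at h3
  rw [Finset.sum_sub_distrib, ← Finset.mul_sum, ← Finset.mul_sum, ← Finset.mul_sum] at h3
  have h5 : ∑ m ∈ S, ∫ x in Q m, u x ^ 2 ∂μ ≤ (2 * ∑ m ∈ S, (∫ x in Q m, u x ∂μ) ^ 2 +
      μ.real D * (ρ ^ 2 * ∫ x, ‖fderiv ℝ u x‖ ^ 2 ∂μ)) / (2 * c) := by
    rw [le_div_iff₀ (by positivity)]
    linarith
  refine h5.trans (le_of_eq ?_)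
  field_simp

end Translation

end HardyForm

/-! ### The cubic grid and the compactness estimate. -/

namespace HardyForm

variable {N k : ℕ} {lam : ℝ}

/-- The half-open cell of side `h` of the cubic grid with index `m`. -/
def gridCell (h : ℝ) (m : Fin N → ℤ) : Set (EuclideanSpace ℝ (Fin N)) :=
  {x | ∀ i, x i ∈ Ico (m i * h) ((m i + 1) * h)}

/-- The open cube of side `2 * h` centred at the origin. -/
def centredCube (N : ℕ) (h : ℝ) : Set (EuclideanSpace ℝ (Fin N)) :=
  {x | ∀ i, x i ∈ Ioo (-h) h}

lemma measurableSet_and_measureReal_box (s : Fin N → Set ℝ) (hs : ∀ i, MeasurableSet (s i)) :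
    MeasurableSet {x : EuclideanSpace ℝ (Fin N) | ∀ i, x i ∈ s i} ∧
    volume.real {x : EuclideanSpace ℝ (Fin N) | ∀ i, x i ∈ s i} = ∏ i, volume.real (s i) := by
  have h1 : {x : EuclideanSpace ℝ (Fin N) | ∀ i, x i ∈ s i} =
      (WithLp.ofLp : EuclideanSpace ℝ (Fin N) → Fin N → ℝ) ⁻¹' (univ.pi s) := by
    ext x; simp
  have hm : MeasurableSet (univ.pi s) := .univ_pi hs
  have hp := PiLp.volume_preserving_ofLp (Fin N)
  rw [h1]
  refine ⟨hp.measurable hm, ?_⟩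
  rw [Measure.real, hp.measure_preimage hm.nullMeasurableSet, volume_pi_pi, ENNReal.toReal_prod]
  rfl

lemma measurableSet_gridCell (h : ℝ) (m : Fin N → ℤ) : MeasurableSet (gridCell h m) :=
  (measurableSet_and_measureReal_box _ fun _ => measurableSet_Ico).1

lemma measureReal_gridCell {h : ℝ} (hh : 0 < h) (m : Fin N → ℤ) :
    volume.real (gridCell h m) = h ^ N := by
  refine (measurableSet_and_measureReal_box _ fun _ => measurableSet_Ico).2.trans ?_
  have : ∀ i, volume.real (Ico (m i * h) ((m i + 1) * h)) = h := fun i => by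
    rw [Real.volume_real_Ico_of_le (by nlinarith)]; ring
  simp [this]

lemma measurableSet_centredCube (h : ℝ) : MeasurableSet (centredCube N h) :=
  (measurableSet_and_measureReal_box _ fun _ => measurableSet_Ioo).1

lemma measureReal_centredCube {h : ℝ} (hh : 0 < h) :
    volume.real (centredCube N h) = (2 * h) ^ N := by
  refine (measurableSet_and_measureReal_box _ fun _ => measurableSet_Ioo).2.trans ?_
  have : volume.real (Ioo (-h) h) = 2 * h := by
    rw [Real.volume_real_Ioo_of_le (by linarith)]; ring
  simp [this]

lemma norm_le_of_mem_centredCube {h : ℝ} (hh : 0 < h) {z : EuclideanSpace ℝ (Fin N)}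
    (hz : z ∈ centredCube N h) : ‖z‖ ≤ √N * h := by
  refine abs_le_of_sq_le_sq' ?_ (by positivity) |>.2
  rw [norm_sq_eq_sum_coord, mul_pow, Real.sq_sqrt (Nat.cast_nonneg _)]
  calc ∑ i, z i ^ 2 ≤ ∑ _i : Fin N, h ^ 2 :=
        Finset.sum_le_sum fun i _ => sq_le_sq' (hz i).1.le (hz i).2.le
    _ = _ := by simp

lemma sub_mem_centredCube {h : ℝ} {m : Fin N → ℤ} {x y : EuclideanSpace ℝ (Fin N)}
    (hx : x ∈ gridCell h m) (hy : y ∈ gridCell h m) : y - x ∈ centredCube N h := fun i => by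
  have h1 := hx i
  have h2 := hy i
  simp only [mem_Ico, mem_Ioo, PiLp.sub_apply] at *
  constructor <;> linarith

lemma mem_gridCell_iff {h : ℝ} (hh : 0 < h) {m : Fin N → ℤ} {x : EuclideanSpace ℝ (Fin N)} :
    x ∈ gridCell h m ↔ ∀ i, ⌊x i / h⌋ = m i := by
  simp only [gridCell, mem_ofPred_eq, Int.floor_eq_iff, mem_Ico, le_div_iff₀ hh, div_lt_iff₀ hh]

lemma pairwise_disjoint_gridCell {h : ℝ} (hh : 0 < h) :
    Pairwise (Function.onFun Disjoint (gridCell (N := N) h)) := fun m n hmn => by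
  refine Set.disjoint_left.2 fun x hx hy => hmn ?_
  rw [mem_gridCell_iff hh] at hx hy
  ext i
  rw [← hx i, hy i]

lemma exists_finset_ball_subset_gridCell {h : ℝ} (hh : 0 < h) (R : ℝ) :
    ∃ S : Finset (Fin N → ℤ), ∀ x : EuclideanSpace ℝ (Fin N), ‖x‖ ≤ R →
      ∃ m ∈ S, x ∈ gridCell h m := by
  refine ⟨Fintype.piFinset fun _ => Finset.Icc (-⌈R / h⌉) ⌈R / h⌉, fun x hx =>
    ⟨fun i => ⌊x i / h⌋, ?_, (mem_gridCell_iff hh).2 fun _ => rfl⟩⟩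
  simp only [Fintype.mem_piFinset, Finset.mem_Icc]
  intro i
  have h1 : |x i| ≤ R := (by simpa using PiLp.norm_apply_le x i : |x i| ≤ ‖x‖).trans hx
  have h2 : |x i / h| ≤ ⌈R / h⌉ := by
    rw [abs_div, abs_of_pos hh]
    exact (div_le_div_of_nonneg_right h1 hh.le).trans (Int.le_ceil _)
  obtain ⟨h3, h4⟩ := abs_le.1 h2
  constructor
  · rw [Int.le_floor]; push_cast; exact h3
  · exact Int.cast_le.1 ((Int.floor_le _).trans h4)

lemma norm_gradient_eq (u : EuclideanSpace ℝ (Fin N) → ℝ) (x : EuclideanSpace ℝ (Fin N)) :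
    ‖∇ u x‖ = ‖fderiv ℝ u x‖ := by
  rw [gradient, LinearIsometryEquiv.norm_map]

/-- A quantitative form of the compactness of `{u | ∇ u ∈ L², ‖x‖ u ∈ L²}` in `L²`: the `L²` norm
is controlled by the averages over finitely many cells, up to a small multiple of the norm. -/
lemma exists_gridCell_integral_sq_le (N : ℕ) {d : ℝ} (hd : 0 < d) :
    ∃ (h : ℝ) (S : Finset (Fin N → ℤ)) (C : ℝ), 0 < h ∧ 0 ≤ C ∧
      ∀ u : EuclideanSpace ℝ (Fin N) → ℝ, ContDiff ℝ 1 u → HasCompactSupport u →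
        ∫ x, u x ^ 2 ≤ d * ((∫ x, ‖∇ u x‖ ^ 2) + ∫ x, ‖x‖ ^ 2 * u x ^ 2)
          + C * ∑ m ∈ S, (∫ x in gridCell h m, u x) ^ 2 := by
  -- The Poincaré constant is `(2h)^N / (2 h^N) * N h² = (2^N / 2) N h²`, which is at most `d` when
  -- `h² = d / K`.
  let K : ℝ := 2 ^ N / 2 * N + 1
  have hK : 0 < K := by positivity
  let h : ℝ := √(d / K)
  have hh : 0 < h := Real.sqrt_pos.2 (by positivity)
  have hh2 : h ^ 2 = d / K := Real.sq_sqrt (by positivity)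
  -- The cells cover the ball of radius `d^(-1/2)`, outside which `1 ≤ d ‖x‖²`.
  obtain ⟨S, hS⟩ := exists_finset_ball_subset_gridCell (N := N) hh (√(1 / d))
  refine ⟨h, S, (h ^ N)⁻¹, hh, by positivity, fun u hu hc => ?_⟩
  have hui2 : Integrable (fun x => u x ^ 2) := (hu.continuous.pow 2).integrable_of_hasCompactSupport
    (hc.mono fun x hx => by
      simp only [Function.mem_support] at hx ⊢
      intro h0; exact hx (by simp [h0]))
  have huc := hu.continuous
  have hux : Integrable (fun x => d * (‖x‖ ^ 2 * u x ^ 2)) :=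
    Continuous.integrable_of_hasCompactSupport (by fun_prop)
    (hc.mono fun x hx => by
      simp only [Function.mem_support] at hx ⊢
      intro h0; exact hx (by simp [h0]))
  have hB : MeasurableSet (⋃ m ∈ S, gridCell h m) :=
    .biUnion S.countable_toSet fun m _ => measurableSet_gridCell h m
  have h1 := sum_setIntegral_sq_le (μ := volume) S hu hc (measurableSet_centredCube h)
    (measurableSet_gridCell h) (pairwise_disjoint_gridCell hh)
    (fun m x hx y hy => sub_mem_centredCube hx hy) (fun z hz => norm_le_of_mem_centredCube hh hz)
    (pow_pos hh N) (measureReal_gridCell hh)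
  rw [← integral_biUnion_finset S (fun m _ => measurableSet_gridCell h m)
    (fun i _ j _ hij => pairwise_disjoint_gridCell hh hij) (fun m _ => hui2.integrableOn)] at h1
  have h2 : ∫ x in (⋃ m ∈ S, gridCell h m)ᶜ, u x ^ 2 ≤ d * ∫ x, ‖x‖ ^ 2 * u x ^ 2 := by
    rw [← integral_const_mul]
    refine (setIntegral_mono_on hui2.integrableOn hux.integrableOn hB.compl fun x hx => ?_).trans
      (setIntegral_le_integral hux (.of_forall fun x => by simp only [Pi.zero_apply]; positivity))
    have h3 : √(1 / d) < ‖x‖ := by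
      by_contra hcon
      obtain ⟨m, hm, hxm⟩ := hS x (not_lt.1 hcon)
      exact hx (mem_biUnion hm hxm)
    have h4 : 1 / d ≤ ‖x‖ ^ 2 := by
      rw [← Real.sq_sqrt (by positivity : 0 ≤ 1 / d)]
      gcongr
    have h5 : 1 ≤ d * ‖x‖ ^ 2 := by rwa [div_le_iff₀' hd] at h4
    nlinarith [sq_nonneg (u x)]
  have h3 : volume.real (centredCube N h) / (2 * h ^ N) * (√N * h) ^ 2 ≤ d := by
    rw [measureReal_centredCube hh, mul_pow, mul_pow, hh2, Real.sq_sqrt (Nat.cast_nonneg _)]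
    have h4 : (2 ^ N * h ^ N) / (2 * h ^ N) * (N * (d / K)) = d * ((2 ^ N / 2 * N) / K) := by
      have := pow_pos hh N
      field_simp
    rw [h4]
    refine mul_le_of_le_one_right hd.le (div_le_one_of_le₀ ?_ hK.le)
    simp only [K]; linarith
  rw [← integral_add_compl hB hui2]
  simp only [norm_gradient_eq]
  have h4 : 0 ≤ ∫ x, ‖fderiv ℝ u x‖ ^ 2 := integral_nonneg fun x => by positivity
  have h5 := mul_le_mul_of_nonneg_right h3 h4
  linarith

lemma integral_orthant_eq {f : EuclideanSpace ℝ (Fin N) → ℝ} {v : EuclideanSpace ℝ (Fin N) → ℝ}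
    (hs : tsupport v ⊆ orthant N k) (hf : ∀ x, x ∉ tsupport v → f x = 0) :
    ∫ x, f x ∂orthantVolume N k = ∫ x, f x :=
  setIntegral_eq_integral_of_forall_compl_eq_zero fun x hx => hf x fun h => hx (hs h)

/-- The compactness estimate for the energy: the `L²` norm is controlled by finitely many
`L²`-continuous linear functionals, up to a small multiple of the energy. -/
lemma exists_finset_integral_sq_le (hN : 2 ≤ N) (hk : k ≤ N) (hlam : lam ≤ hardyConst N k)
    {d : ℝ} (hd : 0 < d) :
    ∃ (S : Finset (Fin N → ℤ)) (g : (Fin N → ℤ) → EuclideanSpace ℝ (Fin N) → ℝ) (C : ℝ), 0 ≤ C ∧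
      (∀ m, MemLp (g m) 2 (orthantVolume N k)) ∧
      ∀ v ∈ formCore N k lam, ∫ x, v x ^ 2 ∂orthantVolume N k ≤ d * energy N k lam v
        + C * ∑ m ∈ S, (∫ x, g m x * v x ∂orthantVolume N k) ^ 2 := by
  -- From `v² ≤ 2(v-u)² + 2u²`, the damping error costs `2 * 3√e = d/2`. The grid estimate for `u`,
  -- with parameter `d/(4K)`, costs `2 * d/4`.
  let e : ℝ := (d / 12) ^ 2
  have he : 0 < e := by positivity
  have hse : √e = d / 12 := Real.sqrt_sq (by positivity)
  let K : ℝ := 2 + (16 + 2 * hardyConst N k) * e⁻¹ + 16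
  have hK : 0 < K := by
    have : 0 ≤ hardyConst N k := sq_nonneg _
    positivity
  obtain ⟨h, S, C, hh, hC, key⟩ := exists_gridCell_integral_sq_le N (d := d / (4 * K))
    (by positivity)
  -- Moving the damping factor from `u` to the cell indicator turns cell integrals of `u` into `L²`
  -- functionals of `v`.
  refine ⟨S, fun m => (gridCell h m).indicator (damping N e), 2 * C, by positivity, fun m => ?_,
    fun v hv => ?_⟩
  · have hfin : volume (gridCell h m) ≠ ⊤ := fun ht => by
      have h1 := measureReal_gridCell hh m
      rw [Measure.real, ht] at h1
      exact (pow_pos hh N).ne h1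
    have h1 : MemLp ((gridCell h m).indicator fun _ : EuclideanSpace ℝ (Fin N) => (1 : ℝ)) 2
        (orthantVolume N k) :=
      memLp_indicator_const 2 (measurableSet_gridCell h m) 1
        (.inr ((Measure.restrict_apply_le _ _).trans_lt hfin.lt_top).ne)
    refine h1.mono ?_ (.of_forall fun x => ?_)
    · exact ((contDiff_damping (n := 0) he).continuous.measurable.indicator
        (measurableSet_gridCell h m)).aestronglyMeasurable
    · by_cases hx : x ∈ gridCell h m
      · simpa [hx, abs_of_nonneg (damping_nonneg he x)] using damping_le_one he x
      · simp [hx]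
  · let u := dampedTest he v
    have hu := key u (contDiff_test u) u.hasCompactSupport
    have h1 := integral_sub_dampedTest_sq_le hN hk hlam hv he
    have h2 := integral_gradient_dampedTest_le hN hk hlam hv he
    have h3 := integral_flow_add_le_energy hN hk hlam hv
    have h3' : 0 ≤ ∫ x, ‖flow N k v x‖ ^ 2 ∂orthantVolume N k :=
      integral_nonneg fun x => by positivity
    have hz : ∀ x, x ∉ tsupport u → u x = 0 := fun x hx => image_eq_zero_of_notMem_tsupport hx
    have hpos : 0 ≤ energy N k lam v := energyNonneg hN hk hlam ⟨v, hv⟩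
    rw [← integral_orthant_eq u.tsupport_subset (f := fun x => u x ^ 2)
        (fun x hx => by simp [hz x hx]),
      ← integral_orthant_eq u.tsupport_subset (f := fun x => ‖∇ u x‖ ^ 2)
        (fun x hx => by
          have h5 := image_eq_zero_of_notMem_tsupport
            fun h => hx (tsupport_fderiv_subset ℝ (f := u) h)
          simp [norm_gradient_eq, h5]),
      ← integral_orthant_eq u.tsupport_subset (f := fun x => ‖x‖ ^ 2 * u x ^ 2)
        (fun x hx => by simp [hz x hx])] at hu
    have h4 : ∫ x, ‖x‖ ^ 2 * u x ^ 2 ∂orthantVolume N k ≤ 16 * energy N k lam v := by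
      have h5 : ∫ x, ‖x‖ ^ 2 * u x ^ 2 ∂orthantVolume N k ≤
          ∫ x, 16 * (‖x‖ ^ 2 / 16 * v x ^ 2) ∂orthantVolume N k := by
        refine integral_mono_of_nonneg (.of_forall fun x => by
          simp only [Pi.zero_apply]; positivity)
          ((integrable_norm_sq_mul v).const_mul 16) (.of_forall fun x => ?_)
        have h6 : u x ^ 2 ≤ v x ^ 2 := by
          change (damping N e x * v x) ^ 2 ≤ v x ^ 2
          rw [mul_pow]
          exact mul_le_of_le_one_left (sq_nonneg _)
            (pow_le_one₀ (damping_nonneg he x) (damping_le_one he x))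
        calc ‖x‖ ^ 2 * u x ^ 2 ≤ ‖x‖ ^ 2 * v x ^ 2 := by gcongr
          _ = _ := by ring
      rw [integral_const_mul] at h5
      linarith
    have h5 : ∫ x, v x ^ 2 ∂orthantVolume N k ≤
        2 * ∫ x, (v - u) x ^ 2 ∂orthantVolume N k + 2 * ∫ x, u x ^ 2 ∂orthantVolume N k := by
      rw [← integral_const_mul, ← integral_const_mul,
        ← integral_add ((integrable_test_sq _).const_mul _) ((integrable_test_sq _).const_mul _)]
      refine integral_mono (integrable_test_sq v) (((integrable_test_sq _).const_mul _).add
        ((integrable_test_sq _).const_mul _)) fun x => ?_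
      change v x ^ 2 ≤ 2 * (v x - u x) ^ 2 + 2 * u x ^ 2
      nlinarith [sq_nonneg (v x - 2 * u x)]
    have h6 : ∀ m, ∫ x in gridCell h m, u x = ∫ x, (gridCell h m).indicator (damping N e) x * v x
        ∂orthantVolume N k := fun m => by
      rw [integral_orthant_eq v.tsupport_subset
        (fun x hx => by rw [image_eq_zero_of_notMem_tsupport hx, mul_zero]),
        ← integral_indicator (measurableSet_gridCell h m)]
      congr 1 with x
      by_cases hx : x ∈ gridCell h m
      · simp [hx]; rfl
      · simp [hx]
    simp only [h6] at hu
    have h7 : d / (4 * K) * (∫ x, ‖∇ u x‖ ^ 2 ∂orthantVolume N k +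
        ∫ x, ‖x‖ ^ 2 * u x ^ 2 ∂orthantVolume N k) ≤ d / 4 * energy N k lam v := by
      calc _ ≤ d / (4 * K) * (K * energy N k lam v) := by
            refine mul_le_mul_of_nonneg_left ?_ (by positivity)
            simp only [K]; linarith
        _ = _ := by field_simp
    rw [hse] at h1
    linarith

end HardyForm

/-! ### Abstract criteria: compactness, extension to the completion, closability. -/

namespace HardyForm

/-- An operator whose norm is controlled by finitely many continuous functionals, up to an
arbitrarily small multiple of the norm, is compact. -/
lemma isCompactOperator_of_estimate {H F κ : Type*} [NormedAddCommGroup H] [NormedSpace ℝ H]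
    [NormedAddCommGroup F] [NormedSpace ℝ F] [CompleteSpace F] (T : H →L[ℝ] F)
    (hT : ∀ d : ℝ, 0 < d → ∃ (S : Finset κ) (l : κ → H →L[ℝ] ℝ) (C : ℝ), 0 ≤ C ∧
      ∀ x, ‖T x‖ ^ 2 ≤ d * ‖x‖ ^ 2 + C * ∑ m ∈ S, (l m x) ^ 2) : IsCompactOperator T := by
  refine (isCompactOperator_iff_isCompact_closure_image_closedBall (T : H →ₗ[ℝ] F) one_pos).2 ?_
  refine TotallyBounded.isCompact_of_isClosed (TotallyBounded.closure ?_) isClosed_closure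
  refine Metric.totallyBounded_iff.2 fun ε hε => ?_
  -- Points of the unit ball differ by at most `2`, which costs `ε²/2`. The radius `δ` is chosen so
  -- that the functionals cost at most `ε²/4`, leaving a total below `ε²`.
  obtain ⟨S, l, C, hC, key⟩ := hT (ε ^ 2 / 8) (by positivity)
  let L : H →L[ℝ] (S → ℝ) := ContinuousLinearMap.pi fun m => l m
  let P : ℝ := C * S.card + 1
  have hP : 0 < P := by positivity
  let δ : ℝ := √(ε ^ 2 / (4 * P))
  have hδ : 0 < δ := Real.sqrt_pos.2 (by positivity)
  have hδ2 : δ ^ 2 = ε ^ 2 / (4 * P) := Real.sq_sqrt (by positivity)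
  have hb : TotallyBounded (L '' Metric.closedBall 0 1) :=
    (L.lipschitz.isBounded_image Metric.isBounded_closedBall).isCompact_closure.totallyBounded.subset
      subset_closure
  -- The net is taken inside the image, so that its points lift to the unit ball.
  obtain ⟨t, hts, htf, htc⟩ := hb.exists_subset (Metric.dist_mem_uniformity hδ)
  have hts' : ∀ y, y ∈ t → ∃ x ∈ Metric.closedBall (0 : H) 1, L x = y := fun y hy => hts hy
  choose! f hf hfL using hts'
  refine ⟨(fun y => T (f y)) '' t, htf.image _, ?_⟩
  rintro _ ⟨x, hx, rfl⟩
  obtain ⟨y, hy, hxy⟩ := mem_iUnion₂.1 (htc (mem_image_of_mem L hx))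
  refine mem_iUnion₂.2 ⟨T (f y), mem_image_of_mem _ hy, ?_⟩
  have hxy' : dist (L x) (L (f y)) < δ := by rw [hfL y hy]; exact hxy
  have h1 : ‖x - f y‖ ≤ 2 := by
    have h2 := norm_sub_le x (f y)
    have h3 := mem_closedBall_zero_iff.1 hx
    have h4 := mem_closedBall_zero_iff.1 (hf y hy)
    linarith
  have h2 : ∑ m ∈ S, (l m (x - f y)) ^ 2 ≤ S.card * δ ^ 2 := by
    rw [← nsmul_eq_mul]
    refine Finset.sum_le_card_nsmul _ _ _ fun m hm => ?_
    have h3 : |l m (x - f y)| ≤ δ := by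
      have h4 := (dist_le_pi_dist (L x) (L (f y)) ⟨m, hm⟩).trans hxy'.le
      rw [Real.dist_eq] at h4
      simpa [L] using h4
    rw [← sq_abs]
    gcongr
  have h3 := key (x - f y)
  have h4 : C * (S.card * δ ^ 2) ≤ ε ^ 2 / 4 := by
    rw [hδ2]
    calc C * (S.card * (ε ^ 2 / (4 * P))) = (C * S.card) / P * (ε ^ 2 / 4) := by field_simp
      _ ≤ 1 * (ε ^ 2 / 4) := by
        gcongr
        exact div_le_one_of_le₀ (by simp only [P]; linarith) hP.le
      _ = _ := one_mul _
  have h5 := mul_le_mul_of_nonneg_left h2 hC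
  have h6 : ε ^ 2 / 8 * ‖x - f y‖ ^ 2 ≤ ε ^ 2 / 8 * 2 ^ 2 := by gcongr
  rw [Metric.mem_ball, dist_eq_norm]
  change ‖T x - T (f y)‖ < ε
  rw [← map_sub]
  refine lt_of_pow_lt_pow_left₀ 2 hε.le ?_
  nlinarith [pow_pos hε 2]

lemma norm_sq_eq_integral {α : Type*} [MeasurableSpace α] {μ : Measure α} {f : Lp ℝ 2 μ}
    {g : α → ℝ} (h : f =ᵐ[μ] g) : ‖f‖ ^ 2 = ∫ x, g x ^ 2 ∂μ := by
  rw [← real_inner_self_eq_norm_sq, L2.inner_def]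
  refine integral_congr_ae (h.mono fun x hx => ?_)
  simp only [hx, real_inner_self_eq_norm_sq, Real.norm_eq_abs, sq_abs]

lemma inner_eq_integral {α : Type*} [MeasurableSpace α] {μ : Measure α} {f₁ f₂ : Lp ℝ 2 μ}
    {g₁ g₂ : α → ℝ} (h₁ : f₁ =ᵐ[μ] g₁) (h₂ : f₂ =ᵐ[μ] g₂) :
    inner ℝ f₁ f₂ = ∫ x, g₁ x * g₂ x ∂μ := by
  rw [L2.inner_def]
  refine integral_congr_ae ?_
  filter_upwards [h₁, h₂] with x h1 h2
  simp [h1, h2, mul_comm]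

variable {N k : ℕ} {lam : ℝ} {hpos : EnergyNonneg N k lam}

lemma norm_sq_coe (v : PreFormDomain N k lam hpos) :
    ‖(v : FormDomain N k lam hpos)‖ ^ 2 = energy N k lam v.toTest := by
  rw [norm_coe, Real.sq_sqrt]
  exact hpos v

/-- A linear map on test functions that is bounded from the energy norm to `L²` extends to the
form domain. -/
lemma exists_extension (T : PreFormDomain N k lam hpos → EuclideanSpace ℝ (Fin N) → ℝ)
    (hm : ∀ v, MemLp (T v) 2 (orthantVolume N k))
    (hadd : ∀ v w x, T (v + w) x = T v x + T w x) (hsmul : ∀ (c : ℝ) v x, T (c • v) x = c * T v x)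
    {C : ℝ} (hC : 0 ≤ C)
    (hb : ∀ v, ∫ x, T v x ^ 2 ∂orthantVolume N k ≤ C * energy N k lam v.toTest) :
    ∃ S : FormDomain N k lam hpos →L[ℝ] Lp ℝ 2 (orthantVolume N k),
      ∀ v : PreFormDomain N k lam hpos,
        S (v : FormDomain N k lam hpos) =ᵐ[orthantVolume N k] T v := by
  let L : PreFormDomain N k lam hpos →ₗ[ℝ] Lp ℝ 2 (orthantVolume N k) :=
    { toFun := fun v => (hm v).toLp
      map_add' := fun v w => by
        rw [← MemLp.toLp_add]
        congr 1
        ext x; exact hadd v w x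
      map_smul' := fun c v => by
        rw [RingHom.id_apply, ← MemLp.toLp_const_smul]
        congr 1
        ext x; exact hsmul c v x }
  let e : PreFormDomain N k lam hpos →ₗ[ℝ] FormDomain N k lam hpos :=
    (UniformSpace.Completion.toComplₗᵢ (𝕜 := ℝ)).toLinearMap
  have hL : ∀ v, L v =ᵐ[orthantVolume N k] T v := fun v => (hm v).coeFn_toLp
  refine ⟨L.extendOfNorm e, fun v => ?_⟩
  have h1 : L.extendOfNorm e (e v) = L v := by
    refine LinearMap.extendOfNorm_eq UniformSpace.Completion.denseRange_coe ⟨√C, fun w => ?_⟩ v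
    refine abs_le_of_sq_le_sq' ?_ (by positivity) |>.2
    rw [norm_sq_eq_integral (hL w), mul_pow, Real.sq_sqrt hC]
    refine (hb w).trans (le_of_eq ?_)
    rw [← norm_sq_coe]
    rfl
  change L.extendOfNorm e (e v) =ᵐ[orthantVolume N k] T v
  rw [h1]
  exact hL v

/-- If, against test functions on an open set of full measure, `S` is adjoint to an operator with
values in `L²`, then `S` vanishes wherever the embedding in `L²` does. -/
lemma eq_zero_of_adjoint {U : Set (EuclideanSpace ℝ (Fin N))} (hU : IsOpen U)
    (hUae : ∀ᵐ x ∂orthantVolume N k, x ∈ U)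
    {ι S : FormDomain N k lam hpos →L[ℝ] Lp ℝ 2 (orthantVolume N k)}
    {T : PreFormDomain N k lam hpos → EuclideanSpace ℝ (Fin N) → ℝ}
    (hι : ∀ v : PreFormDomain N k lam hpos,
      ι (v : FormDomain N k lam hpos) =ᵐ[orthantVolume N k] v.toTest)
    (hS : ∀ v : PreFormDomain N k lam hpos,
      S (v : FormDomain N k lam hpos) =ᵐ[orthantVolume N k] T v)
    (hadj : ∀ χ : EuclideanSpace ℝ (Fin N) → ℝ, ContDiff ℝ 1 χ → HasCompactSupport χ →
      tsupport χ ⊆ U → ∃ χ' : EuclideanSpace ℝ (Fin N) → ℝ, MemLp χ' 2 (orthantVolume N k) ∧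
        ∀ v : PreFormDomain N k lam hpos, ∫ x, χ x * T v x ∂orthantVolume N k =
          ∫ x, χ' x * v.toTest x ∂orthantVolume N k)
    {y : FormDomain N k lam hpos} (hy : ι y = 0) : S y = 0 := by
  have hloc : LocallyIntegrableOn (S y) U (orthantVolume N k) :=
    ((Lp.memLp (S y)).locallyIntegrable (by norm_num)).locallyIntegrableOn U
  have h := hU.ae_eq_zero_of_integral_contDiff_smul_eq_zero hloc fun χ hχ hc hs => by
    have hχ1 : ContDiff ℝ 1 χ := hχ.of_le (by exact_mod_cast le_top)
    obtain ⟨χ', hm', hv⟩ := hadj χ hχ1 hc hs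
    have hm : MemLp χ 2 (orthantVolume N k) := hχ.continuous.memLp_of_hasCompactSupport hc
    -- Both sides are continuous in `z`, so the adjoint relation extends by density. At `y` its
    -- right side is zero.
    have hden : ∀ z : FormDomain N k lam hpos,
        inner ℝ hm.toLp (S z) = inner ℝ hm'.toLp (ι z) := fun z => by
      induction z using UniformSpace.Completion.induction_on with
      | hp => exact isClosed_eq (by fun_prop) (by fun_prop)
      | ih v =>
        rw [inner_eq_integral hm.coeFn_toLp (hS v), inner_eq_integral hm'.coeFn_toLp (hι v), hv v]
    have h1 := hden y
    rw [hy, inner_zero_right, inner_eq_integral hm.coeFn_toLp (Filter.EventuallyEq.refl _ _)] at h1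
    simpa using h1
  refine (Lp.eq_zero_iff_ae_eq_zero).2 ?_
  filter_upwards [h, hUae] with x h1 h2 using h1 h2

end HardyForm

/-! ### Injectivity and compactness of the embedding. -/

namespace HardyForm

variable {N k : ℕ} {lam : ℝ} {hpos : EnergyNonneg N k lam}

lemma measurable_flow_coord (v : 𝓓(orthant N k, ℝ)) (i : Fin N) :
    Measurable (fun x => flow N k v x i) := by
  have h1 : Continuous (v : EuclideanSpace ℝ (Fin N) → ℝ) := v.continuous
  have h2 : Continuous (fun x => ∇ v x i) :=
    (EuclideanSpace.proj i : EuclideanSpace ℝ (Fin N) →L[ℝ] ℝ).continuous.comp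
      (continuous_gradient v)
  have h3 : Measurable (fun x : EuclideanSpace ℝ (Fin N) => x i) :=
    (EuclideanSpace.proj i : EuclideanSpace ℝ (Fin N) →L[ℝ] ℝ).continuous.measurable
  have h4 : Measurable (fun x : EuclideanSpace ℝ (Fin N) => groundField N k x i) := by
    simp only [groundField]
    refine Measurable.sub ?_ (by fun_prop)
    split_ifs
    · exact h3.inv
    · exact measurable_const
  exact h2.measurable.sub (h1.measurable.mul h4)

lemma integrable_flow_coord_sq (hN : 2 ≤ N) (hk : k ≤ N) (v : 𝓓(orthant N k, ℝ)) (i : Fin N) :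
    Integrable (fun x => flow N k v x i ^ 2) (orthantVolume N k) := by
  refine (integral_norm_sq_flow hN hk v).1.mono'
    ((measurable_flow_coord v i).pow_const 2).aestronglyMeasurable (.of_forall fun x => ?_)
  rw [Real.norm_of_nonneg (sq_nonneg _), norm_sq_eq_sum_coord]
  exact Finset.single_le_sum (f := fun i => flow N k v x i ^ 2) (fun i _ => sq_nonneg _)
    (Finset.mem_univ i)

lemma integral_norm_sq_flow_eq_sum (hN : 2 ≤ N) (hk : k ≤ N) (v : 𝓓(orthant N k, ℝ)) :
    ∫ x, ‖flow N k v x‖ ^ 2 ∂orthantVolume N k =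
      ∑ i, ∫ x, flow N k v x i ^ 2 ∂orthantVolume N k := by
  rw [← integral_finsetSum _ fun i _ => integrable_flow_coord_sq hN hk v i]
  simp only [norm_sq_eq_sum_coord]

lemma continuousOn_groundField_coord (i : Fin N) :
    ContinuousOn (fun x : EuclideanSpace ℝ (Fin N) => groundField N k x i)
      ((orthant N k : Set (EuclideanSpace ℝ (Fin N))) \ {0}) := by
  have h3 : Continuous (fun x : EuclideanSpace ℝ (Fin N) => x i) :=
    (EuclideanSpace.proj i : EuclideanSpace ℝ (Fin N) →L[ℝ] ℝ).continuous
  simp only [groundField]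
  refine ContinuousOn.sub ?_ ((continuousOn_const.mul (ContinuousOn.inv₀ (by fun_prop) ?_)).mul
    h3.continuousOn)
  · split_ifs with h
    · exact h3.continuousOn.inv₀ fun x hx => (hx.1 i h).ne'
    · exact continuousOn_const
  · intro x hx
    simpa using hx.2

lemma flow_add (v w : 𝓓(orthant N k, ℝ)) (x : EuclideanSpace ℝ (Fin N)) :
    flow N k (v + w : 𝓓(orthant N k, ℝ)) x = flow N k v x + flow N k w x := by
  rw [flow, gradient_add]
  simp only [flow, FunLike.coe_add, Pi.add_apply, add_smul]
  abel

lemma flow_smul (c : ℝ) (v : 𝓓(orthant N k, ℝ)) (x : EuclideanSpace ℝ (Fin N)) :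
    flow N k (c • v : 𝓓(orthant N k, ℝ)) x = c • flow N k v x := by
  rw [flow, gradient_smul]
  simp only [flow, FunLike.coe_smul, Pi.smul_apply, smul_sub, smul_assoc]

lemma isOpen_orthant_diff : IsOpen ((orthant N k : Set (EuclideanSpace ℝ (Fin N))) \ {0}) :=
  (orthant N k).isOpen.sdiff isClosed_singleton

/-- The adjoint of `v ↦ flow v i`, on test functions supported away from the origin. -/
lemma exists_adjoint_flow_coord (i : Fin N) {χ : EuclideanSpace ℝ (Fin N) → ℝ}
    (hχ : ContDiff ℝ 1 χ) (hc : HasCompactSupport χ)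
    (hs : tsupport χ ⊆ (orthant N k : Set (EuclideanSpace ℝ (Fin N))) \ {0}) :
    ∃ χ' : EuclideanSpace ℝ (Fin N) → ℝ, MemLp χ' 2 (orthantVolume N k) ∧
      ∀ v : 𝓓(orthant N k, ℝ), ∫ x, χ x * flow N k v x i ∂orthantVolume N k =
        ∫ x, χ' x * v x ∂orthantVolume N k := by
  have hA : Continuous fun x => χ x * groundField N k x i :=
    continuous_mul_of_continuousOn isOpen_orthant_diff hχ.continuous hs
      (continuousOn_groundField_coord i)
  have hAc : HasCompactSupport fun x => χ x * groundField N k x i := hc.mul_right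
  have hD : Continuous fun x => ∇ χ x i := by
    simp only [gradient_coord]
    exact (hχ.continuous_fderiv (by simp)).clm_apply continuous_const
  have hDc : HasCompactSupport fun x => ∇ χ x i := by
    have h1 : HasCompactSupport (fderiv ℝ χ) := hc.fderiv (𝕜 := ℝ)
    refine h1.mono fun x hx => ?_
    simp only [Function.mem_support, gradient_coord] at hx ⊢
    intro h0; exact hx (by simp [h0])
  refine ⟨fun x => -(∇ χ x i + χ x * groundField N k x i),
    ((hD.memLp_of_hasCompactSupport hDc).add (hA.memLp_of_hasCompactSupport hAc)).neg, fun v => ?_⟩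
  obtain ⟨a, b, c⟩ := integral_coord_gradient_mul hχ hc (hs.trans sdiff_subset)
    (contDiff_test v).contDiffOn i
  have h1 : Integrable (fun x => χ x * groundField N k x i * v x) (orthantVolume N k) :=
    ((hA.mul v.continuous).integrable_of_hasCompactSupport hAc.mul_right).restrict
  have e1 : ∀ x, χ x * flow N k v x i =
      χ x * ∇ v x i - χ x * groundField N k x i * v x := fun x => by
    simp only [flow, PiLp.sub_apply, PiLp.smul_apply, smul_eq_mul]; ring
  have e2 : ∀ x, -(∇ χ x i + χ x * groundField N k x i) * v x =
      -(∇ χ x i * v x) - χ x * groundField N k x i * v x := fun x => by ring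
  have h2 : Integrable (fun x => -(∇ χ x i * v x)) (orthantVolume N k) := a.neg
  simp only [e1, e2]
  rw [integral_sub b h1, integral_sub h2 h1, integral_neg, c, neg_neg]

/-- Multiplication by a function continuous away from the origin is its own adjoint. -/
lemma exists_adjoint_mul {g : EuclideanSpace ℝ (Fin N) → ℝ}
    (hg : ContinuousOn g ((orthant N k : Set (EuclideanSpace ℝ (Fin N))) \ {0}))
    {χ : EuclideanSpace ℝ (Fin N) → ℝ}
    (hχ : ContDiff ℝ 1 χ) (hc : HasCompactSupport χ)
    (hs : tsupport χ ⊆ (orthant N k : Set (EuclideanSpace ℝ (Fin N))) \ {0}) :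
    ∃ χ' : EuclideanSpace ℝ (Fin N) → ℝ, MemLp χ' 2 (orthantVolume N k) ∧
      ∀ v : 𝓓(orthant N k, ℝ), ∫ x, χ x * (g x * v x) ∂orthantVolume N k =
        ∫ x, χ' x * v x ∂orthantVolume N k :=
  ⟨fun x => χ x * g x, (continuous_mul_of_continuousOn isOpen_orthant_diff hχ.continuous hs
    hg).memLp_of_hasCompactSupport hc.mul_right, fun v => by simp only [mul_assoc]⟩

lemma memLp_two_of_integrable_sq {α : Type*} [MeasurableSpace α] {μ : Measure α} {f : α → ℝ}
    (hf : Measurable f) (h : Integrable (fun x => f x ^ 2) μ) : MemLp f 2 μ :=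
  (memLp_two_iff_integrable_sq hf.aestronglyMeasurable).2 h

/-- The extension to the form domain of a component of the energy given by a multiplication
operator. -/
lemma exists_extension_mul {g : EuclideanSpace ℝ (Fin N) → ℝ} (hg : Measurable g)
    (hi : ∀ v ∈ formCore N k lam, Integrable (fun x => (g x * v x) ^ 2) (orthantVolume N k))
    {C : ℝ} (hC : 0 ≤ C)
    (hb : ∀ v ∈ formCore N k lam,
      ∫ x, (g x * v x) ^ 2 ∂orthantVolume N k ≤ C * energy N k lam v) :
    ∃ S : FormDomain N k lam hpos →L[ℝ] Lp ℝ 2 (orthantVolume N k),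
      ∀ v : PreFormDomain N k lam hpos,
        S (v : FormDomain N k lam hpos) =ᵐ[orthantVolume N k] fun x => g x * v.toTest x := by
  refine exists_extension (fun v x => g x * v.toTest x)
    (fun v => memLp_two_of_integrable_sq (hg.mul v.toTest.continuous.measurable)
      (hi _ v.toTest_mem)) (fun v w x => mul_add _ _ _)
    (fun c v x => mul_left_comm _ _ _) hC fun v => hb _ v.toTest_mem

theorem injective_of_embedding (hN : 2 ≤ N) (hk : k ≤ N) (hlam : lam ≤ hardyConst N k)
    {ι : FormDomain N k lam hpos →L[ℝ] Lp ℝ 2 (orthantVolume N k)}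
    (hι : ∀ v : PreFormDomain N k lam hpos,
      ι (v : FormDomain N k lam hpos) =ᵐ[orthantVolume N k] v.toTest) :
    Function.Injective ι := by
  have hgap := fun v : EuclideanSpace ℝ (Fin N) → ℝ =>
    integral_nonneg (μ := orthantVolume N k) (f := fun x =>
      (hardyConst N k - lam) * (v x ^ 2 * (‖x‖ ^ 2)⁻¹)) (hardy_gap_nonneg hlam v)
  have hpot : ∀ v : EuclideanSpace ℝ (Fin N) → ℝ,
      0 ≤ ∫ x, ‖x‖ ^ 2 / 16 * v x ^ 2 ∂orthantVolume N k := fun v =>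
    integral_nonneg fun x => by simp only [Pi.zero_apply]; positivity
  have hflow : ∀ (v : EuclideanSpace ℝ (Fin N) → ℝ) i,
      0 ≤ ∫ x, flow N k v x i ^ 2 ∂orthantVolume N k := fun v i =>
    integral_nonneg fun x => sq_nonneg _
  have hen : ∀ v ∈ formCore N k lam, energy N k lam v =
      ∑ i, ∫ x, flow N k v x i ^ 2 ∂orthantVolume N k +
      ∫ x, (hardyConst N k - lam) * (v x ^ 2 * (‖x‖ ^ 2)⁻¹) ∂orthantVolume N k +
      ∫ x, ‖x‖ ^ 2 / 16 * v x ^ 2 ∂orthantVolume N k := fun v hv => by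
    rw [energy_eq hN hk hv, integral_norm_sq_flow_eq_sum hN hk]
  have hsum : ∀ v : EuclideanSpace ℝ (Fin N) → ℝ,
      0 ≤ ∑ i, ∫ x, flow N k v x i ^ 2 ∂orthantVolume N k := fun v =>
    Finset.sum_nonneg fun i _ => hflow v i
  have e1 : ∀ (v : EuclideanSpace ℝ (Fin N) → ℝ) y, (√(hardyConst N k - lam) * ‖y‖⁻¹ * v y) ^ 2 =
      (hardyConst N k - lam) * (v y ^ 2 * (‖y‖ ^ 2)⁻¹) := fun v y => by
    rw [mul_pow, mul_pow, Real.sq_sqrt (sub_nonneg.2 hlam), inv_pow]; ring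
  have e2 : ∀ (v : EuclideanSpace ℝ (Fin N) → ℝ) y, (‖y‖ / 4 * v y) ^ 2 =
      ‖y‖ ^ 2 / 16 * v y ^ 2 := fun v y => by ring
  have hF : ∀ i, ∃ S : FormDomain N k lam hpos →L[ℝ] Lp ℝ 2 (orthantVolume N k),
      ∀ v : PreFormDomain N k lam hpos,
        S (v : FormDomain N k lam hpos) =ᵐ[orthantVolume N k] fun x => flow N k v.toTest x i :=
    fun i => by
      refine exists_extension (fun v x => flow N k v.toTest x i)
        (fun v => memLp_two_of_integrable_sq (measurable_flow_coord _ i)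
          (integrable_flow_coord_sq hN hk _ i))
        (fun v w x => congrArg (fun z : EuclideanSpace ℝ (Fin N) => z i)
          (flow_add v.toTest w.toTest x))
        (fun c v x => congrArg (fun z : EuclideanSpace ℝ (Fin N) => z i)
          (flow_smul c v.toTest x)) zero_le_one fun v => ?_
      rw [one_mul, hen _ v.toTest_mem]
      have h1 := Finset.single_le_sum (f := fun i => ∫ x, flow N k v.toTest x i ^ 2
        ∂orthantVolume N k) (fun i _ => hflow _ i) (Finset.mem_univ i)
      have h2 := hgap v.toTest
      have h3 := hpot v.toTest
      simp only at h1
      linarith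
  choose F hF using hF
  obtain ⟨G, hG⟩ := exists_extension_mul (hpos := hpos)
    (g := fun x => √(hardyConst N k - lam) * ‖x‖⁻¹) (by fun_prop)
    (fun v hv => by simpa only [e1] using integrable_hardy_gap hN hk hv) zero_le_one
    (fun v hv => by
      simp only [e1]
      rw [one_mul, hen v hv]
      have h1 := hsum v
      have h3 := hpot v
      linarith)
  obtain ⟨P, hP⟩ := exists_extension_mul (hpos := hpos) (g := fun x => ‖x‖ / 4) (by fun_prop)
    (fun v hv => by simpa only [e2] using integrable_norm_sq_mul v) zero_le_one
    (fun v hv => by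
      simp only [e2]
      rw [one_mul, hen v hv]
      have h1 := hsum v
      have h2 := hgap v
      linarith)
  -- The splitting of the energy on test functions extends by continuity to the whole completion.
  have hnorm : ∀ y, ‖y‖ ^ 2 = ∑ i, ‖F i y‖ ^ 2 + ‖G y‖ ^ 2 + ‖P y‖ ^ 2 := fun y => by
    induction y using UniformSpace.Completion.induction_on with
    | hp => exact isClosed_eq (by fun_prop) (by fun_prop)
    | ih v =>
      rw [norm_sq_coe, norm_sq_eq_integral (hG v), norm_sq_eq_integral (hP v), hen _ v.toTest_mem]
      simp only [e1, e2, fun i => norm_sq_eq_integral (hF i v)]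
  have hU : ∀ᵐ x ∂orthantVolume N k, x ∈ (orthant N k : Set (EuclideanSpace ℝ (Fin N))) \ {0} :=
    ae_mem_orthant_and_ne_zero hN
  refine (injective_iff_map_eq_zero ι).2 fun y hy => ?_
  have h1 : ∀ i, F i y = 0 := fun i => eq_zero_of_adjoint isOpen_orthant_diff hU hι (hF i)
    (fun χ hχ hc hs => by
      obtain ⟨χ', hm, h⟩ := exists_adjoint_flow_coord i hχ hc hs
      exact ⟨χ', hm, fun v => h v.toTest⟩) hy
  have h2 : G y = 0 := eq_zero_of_adjoint isOpen_orthant_diff hU hι hG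
    (fun χ hχ hc hs => by
      obtain ⟨χ', hm, h⟩ := exists_adjoint_mul (N := N) (k := k)
        (g := fun x => √(hardyConst N k - lam) * ‖x‖⁻¹)
        (continuousOn_const.mul (continuous_norm.continuousOn.inv₀ fun x hx => by
          simpa using hx.2)) hχ hc hs
      exact ⟨χ', hm, fun v => h v.toTest⟩) hy
  have h3 : P y = 0 := eq_zero_of_adjoint isOpen_orthant_diff hU hι hP
    (fun χ hχ hc hs => by
      obtain ⟨χ', hm, h⟩ := exists_adjoint_mul (N := N) (k := k)
        (g := fun x => ‖x‖ / 4) (by fun_prop) hχ hc hs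
      exact ⟨χ', hm, fun v => h v.toTest⟩) hy
  have h4 := hnorm y
  simpa [h1, h2, h3] using h4

/-- The functionals of `exists_finset_integral_sq_le` are pairings with fixed `L²` functions, so
they factor through `ι`, and the inequality is a closed condition that passes to the completion. -/
theorem isCompactOperator_of_embedding (hN : 2 ≤ N) (hk : k ≤ N) (hlam : lam ≤ hardyConst N k)
    {ι : FormDomain N k lam hpos →L[ℝ] Lp ℝ 2 (orthantVolume N k)}
    (hι : ∀ v : PreFormDomain N k lam hpos,
      ι (v : FormDomain N k lam hpos) =ᵐ[orthantVolume N k] v.toTest) :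
    IsCompactOperator ι := by
  refine isCompactOperator_of_estimate (κ := Fin N → ℤ) ι fun d hd => ?_
  obtain ⟨S, g, C, hC, hg, key⟩ := exists_finset_integral_sq_le hN hk hlam hd
  refine ⟨S, fun m => (innerSL ℝ (hg m).toLp).comp ι, C, hC, fun y => ?_⟩
  simp only [ContinuousLinearMap.comp_apply, innerSL_apply_apply]
  induction y using UniformSpace.Completion.induction_on with
  | hp => exact isClosed_le (by fun_prop) (by fun_prop)
  | ih v =>
    rw [norm_sq_coe, norm_sq_eq_integral (hι v)]
    simp only [fun m => inner_eq_integral (hg m).coeFn_toLp (hι v)]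
    exact key _ v.toTest_mem

end HardyForm

theorem mainTheorem4 (N k : ℕ) (hN : 2 ≤ N) (hk : k ≤ N) (lam : ℝ)
    (hlam : lam ≤ HardyForm.hardyConst N k) :
    ∃ hpos : HardyForm.EnergyNonneg N k lam,
      ∃ ι : HardyForm.FormDomain N k lam hpos →L[ℝ] Lp ℝ 2 (HardyForm.orthantVolume N k),
        (∀ v : HardyForm.PreFormDomain N k lam hpos,
          ι (v : HardyForm.FormDomain N k lam hpos) =ᵐ[HardyForm.orthantVolume N k] v.toTest) ∧
        Function.Injective ι ∧
        IsCompactOperator ι := by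
  have hpos := HardyForm.energyNonneg hN hk hlam
  -- The embedding is multiplication by `1`, bounded with constant `2` by the spectral bound.
  obtain ⟨ι, hι⟩ := HardyForm.exists_extension_mul (hpos := hpos) (g := fun _ => 1)
    measurable_const (fun v _ => by simpa using HardyForm.integrable_test_sq v) zero_le_two
    (fun v hv => by simpa using HardyForm.integral_sq_le_energy hN hk hlam hv)
  simp only [one_mul] at hι
  exact ⟨hpos, ι, hι, HardyForm.injective_of_embedding hN hk hlam hι,
    HardyForm.isCompactOperator_of_embedding hN hk hlam hι⟩
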